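/- Consider a primary link and a secondary (SU) link. Fix an integer $L\ge 2$ and reals $0<\lambda<1$, $\theta_p,\theta_s,P_p,P_{\max},\sigma^2>0$, and put $\gamma_p=P_p/\sigma^2$, $\gamma_{\max}=P_{\max}/\sigma^2$. Let $\mathcal{CN}(0,v)$ be the circularly symmetric complex Gaussian law of variance $v$. Model. The primary channel $h_p$ is $\mathcal{CN}(0,1)$; the channel $\mathbf h_x\in\mathbb C^L$ from the SU transmitter to the primary receiver has i.i.d. $\mathcal{CN}(0,\lambda)$ entries; the SU channel $\mathbf h_s\in\mathbb C^L$ has i.i.d. $\mathcal{CN}(0,1)$ entries. Write $g_p=|h_p|^2$, $g_x=\|\mathbf h_x\|^2/\lambda$, $g_s=\|\mathbf h_s\|^2$, $\mathbf s_x=\mathbf h_x/\|\mathbf h_x\|$, $\mathbf s_s=\mathbf h_s/\|\mathbf h_s\|$. The direction $\mathbf s_x$ is quantized with $B\in\{0,1,2,\dots\}$ bits to a random unit vector $\hat{\mathbf s}_x$ whose error $\epsilon=1-|\hat{\mathbf s}_x^\dagger\mathbf s_x|^2$ satisfies $\Pr(\epsilon\le\tau)=2^B\tau^{L-1}$ for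 $0\le\tau\le 2^{-B/(L-1)}$ (and $\Pr(\epsilon\le\tau)=1$ for larger $\tau$). The gain $g_x$ is independent of $(\mathbf s_x,\hat{\mathbf s}_x)$, and $(\mathbf h_x,\hat{\mathbf s}_x)$, $\mathbf h_s$, $h_p$ are mutually independent. Orthogonal cognitive beamforming (OCB) with feedforward and perfect power-control feedback. Let $\hat{\mathbf s}_\perp$ be the normalized component of $\mathbf s_s$ orthogonal to $\hat{\mathbf s}_x$, $\delta=|\mathbf s_x^\dagger\hat{\mathbf s}_\perp|^2$ and $\omega=\sigma^2(\gamma_pg_p/\theta_p-1)$. The power budget is $\acute P_s=\min\{\omega/(\lambda g_x\delta),P_{\max}\}$ if $\omega\ge0$ and $\acute P_s=P_{\max}$ if $\omega<0$. The beamformer $\mathbf f$ maximizes $|\mathbf f^\dagger\mathbf s_s|^2$ subject to $\mathbf f^\dagger\hat{\mathbf s}_x=0$ and $\|\mathbf f\|^2\le\acute P_s$. The SU outage probability is $$\acute P_{\rm out}=\Pr\left(\frac{g_s}{\sigma^2}|\mathbf f^\dagger\mathbf s_s|^2\le\theta_s\right).$$ Theorem. With $\Gamma(s,x)=\int_x^\infty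 t^{s-1}e^{-t}\,dt$, $$\acute P_{\rm out}=1-\frac{\Gamma\left(L-1,\frac{\theta_s}{\gamma_{\max}}\right)}{\Gamma(L-1)}+\frac{\varphi}{L-1}\,2^{-\frac{B}{L-1}}+O\left(2^{-\frac{2B}{L-1}}\right),\qquad \varphi=e^{-\frac{\theta_p}{\gamma_p}}\,\frac{(L-1)\lambda\theta_p\theta_s\,\Gamma\left(L-2,\frac{\theta_s}{\gamma_{\max}}\right)}{\gamma_p\,\Gamma(L-1)},$$ where the implied constant depends only on $L,\lambda,\theta_p,\theta_s,P_p,P_{\max},\sigma^2$, and not on $B$. -/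

import Mathlib

open MeasureTheory ProbabilityTheory

noncomputable section

namespace CognitiveBeamforming

/-- The upper incomplete gamma function `Γ(s, x) = ∫_x^∞ t^(s-1) e^(-t) dt` (for `x > 0`). -/
def upperGamma (s x : ℝ) : ℝ := ∫ t in Set.Ioi x, t ^ (s - 1) * Real.exp (-t)

/-- The circularly symmetric complex Gaussian law `CN(0, v)`: real and imaginary parts are
independent real centred Gaussians of variance `v / 2`. -/
def complexGaussian (v : ℝ) : Measure ℂ :=
  ((gaussianReal 0 (v / 2).toNNReal).prod (gaussianReal 0 (v / 2).toNNReal)).map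
    Complex.measurableEquivRealProd.symm

/-- Vectors in `ℂ^L` with the Euclidean norm.
Note that `inner ℂ u v` is `u† v` (conjugate-linear in `u`). -/
abbrev CVec (L : ℕ) : Type := EuclideanSpace ℂ (Fin L)

/-- The direction `h / ‖h‖` of a vector. -/
def shape {L : ℕ} (h : CVec L) : CVec L := ((‖h‖⁻¹ : ℝ) : ℂ) • h

/-- The random vector `h` has i.i.d. `CN(0, v)` entries. -/
def IsIIDComplexGaussian {Ω : Type*} [MeasurableSpace Ω] {L : ℕ} (μ : Measure Ω)
    (v : ℝ) (h : Ω → CVec L) : Prop :=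
  iIndepFun (fun (i : Fin L) (ω : Ω) => h ω i) μ ∧
    ∀ i, HasLaw (fun ω => h ω i) (complexGaussian v) μ

/-- The deterministic parameters of the system. -/
structure Params where
  /-- number of antennas at the secondary transmitter -/
  L : ℕ
  /-- relative path loss of the cross link -/
  lam : ℝ
  /-- SINR threshold of the primary receiver -/
  thetaP : ℝ
  /-- SNR threshold of the secondary receiver -/
  thetaS : ℝ
  /-- primary transmission power -/
  Pp : ℝ
  /-- maximal secondary transmission power -/
  Pmax : ℝ
  /-- noise power `σ²` -/
  noise : ℝ

namespace Params

/-- The primary transmit SNR. -/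
def gammaP (p : Params) : ℝ := p.Pp / p.noise

/-- The maximal secondary transmit SNR. -/
def gammaMax (p : Params) : ℝ := p.Pmax / p.noise

/-- The coefficient of the quantization term for beamforming without feedforward. -/
def phi (p : Params) : ℝ :=
  Real.exp (-(p.thetaP / p.gammaP)) *
    ((((p.L : ℝ) - 1) * p.lam * p.thetaP * p.thetaS *
        upperGamma ((p.L : ℝ) - 2) (p.thetaS / p.gammaMax)) /
      (p.gammaP * Real.Gamma ((p.L : ℝ) - 1)))

end Params

/-- The quantization error `ε = 1 - |ŝ† s|²` of the channel direction `s`. -/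
def cdiError {L : ℕ} (sHat s : CVec L) : ℝ := 1 - ‖inner ℂ sHat s‖ ^ 2

/-- The distribution function of the quantization error with `B` feedback bits. -/
def cdiErrorCDF (L B : ℕ) (τ : ℝ) : ℝ :=
  if τ < 0 then 0
  else if τ ≤ (2 : ℝ) ^ (-((B : ℝ) / ((L : ℝ) - 1))) then (2 : ℝ) ^ B * τ ^ (L - 1)
  else 1

/-- The unit vector `ŝ_⊥ ⟂ ŝ` in the decomposition `s_s = a ŝ + b ŝ_⊥` (for a unit vector `ŝ`). -/
def perpDir {L : ℕ} (sHat ss : CVec L) : CVec L := shape (ss - (inner ℂ sHat ss : ℂ) • sHat)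

/-- `ω = σ² (γ_p g_p / θ_p - 1)`, the interference margin of the primary receiver. -/
def margin (p : Params) (gp : ℝ) : ℝ := p.noise * (p.gammaP * gp / p.thetaP - 1)

/-- The unquantized interference power control signal with feedforward: `ω / (λ g_x δ)` if
`ω ≥ 0`, and `P_max` otherwise, where `g_x = ‖h_x‖² / λ` and `δ = |s_x† ŝ_⊥|²`.
(The denominator vanishes only on an event of probability zero.) -/
def ipcFeedforward (p : Params) (hp : ℂ) (hx sHat hs : CVec p.L) : ℝ :=
  let gp := ‖hp‖ ^ 2
  let gx := ‖hx‖ ^ 2 / p.lam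
  let δ := ‖inner ℂ (shape hx) (perpDir sHat (shape hs))‖ ^ 2
  if 0 ≤ margin p gp then margin p gp / (p.lam * gx * δ) else p.Pmax

/-- The power budget of the secondary transmitter: the perfectly fed back power control signal,
capped at `P_max`. -/
def powerBudget (p : Params) (hp : ℂ) (hx sHat hs : CVec p.L) : ℝ :=
  min (ipcFeedforward p hp hx sHat hs) p.Pmax

/-- `f` is an orthogonal cognitive beamformer: it maximizes `|f† s_s|²` subject to `f† ŝ = 0` and
`‖f‖² ≤ P`. -/
def IsOCB {L : ℕ} (sHat ss : CVec L) (P : ℝ) (f : CVec L) : Prop :=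
  f ∈ {v : CVec L | inner ℂ v sHat = 0 ∧ ‖v‖ ^ 2 ≤ P} ∧
    IsMaxOn (fun v : CVec L => ‖inner ℂ v ss‖ ^ 2)
      {v : CVec L | inner ℂ v sHat = 0 ∧ ‖v‖ ^ 2 ≤ P} f

/-- The receive SNR of the secondary link, `(g_s / σ²) |f† s_s|²` with `g_s = ‖h_s‖²`. -/
def snrS (p : Params) (hs f : CVec p.L) : ℝ :=
  ‖hs‖ ^ 2 / p.noise * ‖inner ℂ f (shape hs)‖ ^ 2

/-- Orthogonal cognitive beamforming with feedforward, `B` bits of channel-direction feedback and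
perfect power-control feedback.  Here `hp`, `hx`, `hs` are the primary channel, the channel from the
secondary transmitter to the primary receiver and the channel of the secondary link, `sHat` is the
quantized direction of `hx` and `f` the beamformer. -/
structure IsOCBFeedforward {Ω : Type*} [MeasurableSpace Ω] (μ : Measure Ω) (p : Params) (B : ℕ)
    (hp : Ω → ℂ) (hx hs sHat f : Ω → CVec p.L) : Prop where
  law_hp : HasLaw hp (complexGaussian 1) μ
  law_hx : IsIIDComplexGaussian μ p.lam hx
  law_hs : IsIIDComplexGaussian μ 1 hs
  aemeasurable_sHat : AEMeasurable sHat μ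
  norm_sHat : ∀ᵐ ω ∂μ, ‖sHat ω‖ = 1
  cdf_cdiError : ∀ τ : ℝ,
    μ.real {ω | cdiError (sHat ω) (shape (hx ω)) ≤ τ} = cdiErrorCDF p.L B τ
  /-- The quantizer acts on the direction of `hx` only. -/
  indep_gain : IndepFun (fun ω => ‖hx ω‖) (fun ω => (shape (hx ω), sHat ω)) μ
  indep_hs : IndepFun (fun ω => (hx ω, sHat ω)) hs μ
  indep_hp : IndepFun (fun ω => ((hx ω, sHat ω), hs ω)) hp μ
  beamformer : ∀ᵐ ω ∂μ, IsOCB (sHat ω) (shape (hs ω))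
    (powerBudget p (hp ω) (hx ω) (sHat ω) (hs ω)) (f ω)

/-- The outage probability of the secondary link. -/
def outageProb {Ω : Type*} [MeasurableSpace Ω] (μ : Measure Ω) (p : Params)
    (hs f : Ω → CVec p.L) : ℝ :=
  μ.real {ω | snrS p (hs ω) (f ω) ≤ p.thetaS}

end CognitiveBeamforming

end

/-!
Given the cross channel `h_x` and the quantized direction `ŝ`, the component `h_⊥` of `h_s`
orthogonal to `ŝ` is a standard Gaussian vector of dimension `L - 1`, and the beamformer points
along it. With `x = (θ_pθ_s/γ_p) |h_x†h_⊥|²/‖h_⊥‖⁴`, the secondary link is in outage iff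
`‖h_⊥‖² ≤ θ_s/γ_max` or `θ_p/γ_p ≤ g_p ≤ θ_p/γ_p + x`. As `g_p` is exponential, the second event
has conditional probability `e^{-θ_p/γ_p}(1 - e^{-x})`, which is `e^{-θ_p/γ_p} x` up to `x²/2`;
outside the first event, `x` is at most `θ_pγ_max/γ_p` times `ε‖h_x‖²`, where `ε` is the
quantization error. By isotropy, the mean of `|h_x†h_⊥|²` given `‖h_⊥‖` is
`‖h_⊥‖² ε‖h_x‖²/(L - 1)`, so the main term follows from the mean `(L - 1)/L · 2^{-B/(L-1)}` of
`ε`, and the error term from `ε ≤ 2^{-B/(L-1)}`.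
-/

noncomputable section

namespace CognitiveBeamforming

open Module (finrank)
open scoped Real

section Independence

variable {α β Ω : Type*} [MeasurableSpace α] [MeasurableSpace β] [MeasurableSpace Ω]

lemma measureReal_prod_eq_integral (μ : Measure α) (ν : Measure β) [IsFiniteMeasure μ]
    [IsFiniteMeasure ν] {s : Set (α × β)} (hs : MeasurableSet s) :
    (μ.prod ν).real s = ∫ x, ν.real (Prod.mk x ⁻¹' s) ∂μ := by
  rw [measureReal_def, Measure.prod_apply hs]
  exact (integral_toReal (measurable_measure_prodMk_left hs).aemeasurable
    (Filter.Eventually.of_forall fun x => measure_lt_top ν _)).symm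

variable {μ : Measure Ω} [IsFiniteMeasure μ] {X : Ω → α} {Y : Ω → β}

lemma measureReal_mem_eq_integral_of_indepFun (hXY : IndepFun X Y μ) (hX : AEMeasurable X μ)
    (hY : AEMeasurable Y μ) {s : Set (α × β)} (hs : MeasurableSet s) :
    μ.real {ω | (X ω, Y ω) ∈ s} = ∫ ω, (μ.map Y).real (Prod.mk (X ω) ⁻¹' s) ∂μ := by
  have hlaw := (indepFun_iff_map_prod_eq_prod_map_map hX hY).1 hXY
  calc μ.real {ω | (X ω, Y ω) ∈ s} = ((μ.map X).prod (μ.map Y)).real s := by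
        rw [← hlaw, map_measureReal_apply_of_aemeasurable (hX.prodMk hY) hs]; rfl
    _ = _ := by
        rw [measureReal_prod_eq_integral _ _ hs, integral_map hX]
        exact (measurable_measure_prodMk_left hs).ennreal_toReal.aestronglyMeasurable

lemma ae_mem_of_indepFun (hXY : IndepFun X Y μ) (hX : AEMeasurable X μ) (hY : AEMeasurable Y μ)
    {s : Set (α × β)} (hs : MeasurableSet s) (h : ∀ᵐ ω ∂μ, ∀ᵐ y ∂μ.map Y, (X ω, y) ∈ s) :
    ∀ᵐ ω ∂μ, (X ω, Y ω) ∈ s := by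
  have hnull : μ.real {ω | (X ω, Y ω) ∈ sᶜ} = 0 := by
    rw [measureReal_mem_eq_integral_of_indepFun hXY hX hY hs.compl]
    refine integral_eq_zero_of_ae (h.mono fun ω hω => ?_)
    exact (measureReal_eq_zero_iff).2 (ae_iff.1 hω)
  exact ae_iff.2 ((measureReal_eq_zero_iff).1 hnull)

lemma indepFun_prodMk_of_indepFun_prodMk {γ : Type*} [MeasurableSpace γ] {Z : Ω → γ}
    (hX : AEMeasurable X μ) (hY : AEMeasurable Y μ) (hZ : AEMeasurable Z μ)
    (hXY : IndepFun X Y μ) (hXYZ : IndepFun (fun ω => (X ω, Y ω)) Z μ) :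
    IndepFun X (fun ω => (Y ω, Z ω)) μ := by
  have hYZ : IndepFun Y Z μ := hXYZ.comp measurable_snd measurable_id
  rw [indepFun_iff_map_prod_eq_prod_map_map (hX.prodMk hY) hZ,
    (indepFun_iff_map_prod_eq_prod_map_map hX hY).1 hXY] at hXYZ
  rw [indepFun_iff_map_prod_eq_prod_map_map hX (hY.prodMk hZ),
    (indepFun_iff_map_prod_eq_prod_map_map hY hZ).1 hYZ, ← Measure.prodAssoc_prod, ← hXYZ]
  exact (AEMeasurable.map_map_of_aemeasurable
    MeasurableEquiv.prodAssoc.measurable.aemeasurable ((hX.prodMk hY).prodMk hZ)).symm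

lemma abs_measureReal_mem_sub_integral_le_of_indepFun (hXY : IndepFun X Y μ)
    (hX : AEMeasurable X μ) (hY : AEMeasurable Y μ) {s : Set (α × β)} (hs : MeasurableSet s)
    {g b : Ω → ℝ} (hg : Integrable g μ) (hb : Integrable b μ)
    (h : ∀ᵐ ω ∂μ, |(μ.map Y).real (Prod.mk (X ω) ⁻¹' s) - g ω| ≤ b ω) :
    |μ.real {ω | (X ω, Y ω) ∈ s} - ∫ ω, g ω ∂μ| ≤ ∫ ω, b ω ∂μ := by
  have hint : Integrable (fun ω => (μ.map Y).real (Prod.mk (X ω) ⁻¹' s)) μ :=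
    (Measure.integrable_measure_prodMk_left hs (measure_ne_top _ _)).comp_aemeasurable hX
  rw [measureReal_mem_eq_integral_of_indepFun hXY hX hY hs, ← integral_sub hint hg,
    ← Real.norm_eq_abs]
  exact norm_integral_le_of_norm_le hb h

end Independence

section GammaLaw

lemma upperGamma_zero {s : ℝ} (hs : 0 < s) : upperGamma s 0 = Real.Gamma s := by
  simp only [upperGamma, Real.Gamma_eq_integral hs, mul_comm]

lemma ae_pos_gammaMeasure (s r : ℝ) : ∀ᵐ t ∂gammaMeasure s r, 0 < t := by
  have hIic : gammaMeasure s r (Set.Iic 0) = 0 := by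
    rw [gammaMeasure, withDensity_apply _ measurableSet_Iic,
      setLIntegral_congr Iio_ae_eq_Iic.symm, lintegral_gammaPDF_of_nonpos le_rfl]
  exact (measure_eq_zero_iff_ae_notMem.1 hIic).mono fun _ ht => not_le.1 ht

lemma setIntegral_Ioi_gammaMeasure_one {s a : ℝ} (hs : 0 < s) (ha : 0 ≤ a) (g : ℝ → ℝ) :
    ∫ t in Set.Ioi a, g t ∂gammaMeasure s 1
      = ∫ t in Set.Ioi a, t ^ (s - 1) * Real.exp (-t) / Real.Gamma s * g t := by
  rw [gammaMeasure, setIntegral_withDensity_eq_setIntegral_toReal_smul (f := gammaPDF s 1)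
    (measurable_gammaPDFReal s 1).ennreal_ofReal (by simp [gammaPDF]) _ measurableSet_Ioi]
  refine setIntegral_congr_fun measurableSet_Ioi fun t (hat : a < t) => ?_
  rw [gammaPDF, ENNReal.toReal_ofReal (gammaPDFReal_nonneg hs one_pos t), gammaPDFReal,
    if_pos (ha.trans hat.le), Real.one_rpow, one_mul, smul_eq_mul]
  ring

lemma integral_gammaMeasure_one {s : ℝ} (hs : 0 < s) (g : ℝ → ℝ) :
    ∫ t, g t ∂gammaMeasure s 1
      = ∫ t in Set.Ioi 0, t ^ (s - 1) * Real.exp (-t) / Real.Gamma s * g t := by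
  rw [← setIntegral_Ioi_gammaMeasure_one hs le_rfl,
    Measure.restrict_eq_self_of_ae_mem (s := Set.Ioi 0) (ae_pos_gammaMeasure s 1)]

lemma setIntegral_rpow_gammaMeasure {s a : ℝ} (hs : 0 < s) (ha : 0 ≤ a) (k : ℝ) :
    ∫ t in Set.Ioi a, t ^ k ∂gammaMeasure s 1 = upperGamma (s + k) a / Real.Gamma s := by
  rw [setIntegral_Ioi_gammaMeasure_one hs ha, upperGamma, ← integral_div]
  refine setIntegral_congr_fun measurableSet_Ioi fun t (hat : a < t) => ?_
  simp only [add_sub_right_comm, Real.rpow_add (ha.trans_lt hat)]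
  ring

lemma gammaMeasure_real_Ioi {s a : ℝ} (hs : 0 < s) (ha : 0 ≤ a) :
    (gammaMeasure s 1).real (Set.Ioi a) = upperGamma s a / Real.Gamma s := by
  simpa using setIntegral_rpow_gammaMeasure hs ha 0

lemma integral_pow_gammaMeasure {s : ℝ} (hs : 0 < s) (k : ℕ) :
    ∫ t, t ^ k ∂gammaMeasure s 1 = Real.Gamma (s + k) / Real.Gamma s := by
  have h := setIntegral_rpow_gammaMeasure hs le_rfl k
  rwa [Measure.restrict_eq_self_of_ae_mem (s := Set.Ioi 0) (ae_pos_gammaMeasure s 1),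
    upperGamma_zero (by positivity), integral_congr_ae (.of_forall fun t => Real.rpow_natCast t k)]
    at h

lemma integrable_pow_gammaMeasure {s : ℝ} (hs : 0 < s) (k : ℕ) :
    Integrable (fun t => t ^ k) (gammaMeasure s 1) := by
  refine .of_integral_ne_zero ?_
  rw [integral_pow_gammaMeasure hs]
  exact (div_pos (Real.Gamma_pos_of_pos (by positivity)) (Real.Gamma_pos_of_pos hs)).ne'

instance isProbabilityMeasure_expMeasure_one : IsProbabilityMeasure (expMeasure 1) :=
  isProbabilityMeasure_expMeasure one_pos

lemma expMeasure_one_real_Icc_add {t x : ℝ} (ht : 0 ≤ t) (hx : 0 ≤ x) :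
    (expMeasure 1).real (Set.Icc t (t + x)) = Real.exp (-t) * (1 - Real.exp (-x)) := by
  have hatom : NullSingletonClass (expMeasure 1) := nullSingletonClass_withDensity _
  have hIic : ∀ b, 0 ≤ b → (expMeasure 1).real (Set.Iic b) = 1 - Real.exp (-b) := fun b hb => by
    rw [← cdf_eq_real, cdf_expMeasure_eq one_pos, if_pos hb, one_mul]
  calc (expMeasure 1).real (Set.Icc t (t + x))
      = (expMeasure 1).real (Set.Iic (t + x) \ Set.Iic t) := by
        rw [Set.Iic_sdiff_Iic]
        exact measureReal_congr Ioc_ae_eq_Icc.symm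
    _ = Real.exp (-t) * (1 - Real.exp (-x)) := by
        rw [measureReal_sdiff (Set.Iic_subset_Iic.2 (by linarith)) measurableSet_Iic,
          hIic _ (by positivity), hIic t ht, neg_add, Real.exp_add]
        ring

lemma abs_one_sub_exp_neg_sub_le {y : ℝ} (hy : 0 ≤ y) : |1 - Real.exp (-y) - y| ≤ y ^ 2 / 2 := by
  have hlower := Real.one_sub_le_exp_neg y
  have hupper : Real.exp (-y) ≤ 1 - y + y ^ 2 / 2 := by
    rw [Real.exp_neg, inv_le_iff_one_le_mul₀ (Real.exp_pos y)]
    calc (1 : ℝ) ≤ (1 - y + y ^ 2 / 2) * (1 + y + y ^ 2 / 2) := by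
          nlinarith [sq_nonneg (y ^ 2)]
      _ ≤ (1 - y + y ^ 2 / 2) * Real.exp y :=
          mul_le_mul_of_nonneg_left (Real.quadratic_le_exp_of_nonneg hy)
            (by nlinarith [sq_nonneg (1 - y)])
  rw [abs_le]
  constructor <;> linarith

lemma abs_expMeasure_one_real_Icc_add_sub_le {t x : ℝ} (ht : 0 ≤ t) (hx : 0 ≤ x) :
    |(expMeasure 1).real (Set.Icc t (t + x)) - Real.exp (-t) * x| ≤ x ^ 2 / 2 := by
  rw [expMeasure_one_real_Icc_add ht hx, ← mul_sub, abs_mul, abs_of_pos (Real.exp_pos _)]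
  calc Real.exp (-t) * |1 - Real.exp (-x) - x| ≤ 1 * (x ^ 2 / 2) :=
        mul_le_mul (Real.exp_le_one_iff.2 (by linarith)) (abs_one_sub_exp_neg_sub_le hx)
          (abs_nonneg _) zero_le_one
    _ = x ^ 2 / 2 := one_mul _

lemma abs_measureReal_prod_expMeasure_sub_le {Y : Type*} [MeasurableSpace Y] (ν : Measure Y)
    [IsProbabilityMeasure ν] {A : Set Y} (hA : MeasurableSet A) {x : Y → ℝ} (hx : Measurable x)
    {M t : ℝ} (ht : 0 ≤ t) (hxM : ∀ y ∈ A, x y ∈ Set.Icc 0 M) :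
    |(ν.prod (expMeasure 1)).real {q | q.1 ∉ A ∨ q.2 ∈ Set.Icc t (t + x q.1)} -
      (1 - ν.real A + Real.exp (-t) * ∫ y in A, x y ∂ν)| ≤ M ^ 2 / 2 := by
  set S : Set (Y × ℝ) := {q | q.1 ∉ A ∨ q.2 ∈ Set.Icc t (t + x q.1)}
  have hS : MeasurableSet S :=
    (measurable_fst hA.compl).union ((measurableSet_le measurable_const measurable_snd).inter
      (measurableSet_le measurable_snd (by fun_prop)))
  have hfiber : ∀ y ∈ A, Prod.mk y ⁻¹' S = Set.Icc t (t + x y) := fun y hy => by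
    ext r
    simp only [S, Set.mem_preimage, Set.mem_ofPred_eq, hy, not_true_eq_false, false_or]
  have hfiber_compl : ∀ y ∈ Aᶜ, (expMeasure 1).real (Prod.mk y ⁻¹' S) = 1 := fun y hy => by
    rw [show Prod.mk y ⁻¹' S = Set.univ from Set.eq_univ_of_forall fun _ => .inl hy, probReal_univ]
  have hxint : IntegrableOn x A ν := by
    refine Integrable.of_bound hx.aestronglyMeasurable M ?_
    filter_upwards [ae_restrict_mem hA] with y hy
    exact abs_le.2 ⟨by linarith [(hxM y hy).1, (hxM y hy).2], (hxM y hy).2⟩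
  have hfint := Measure.integrable_measure_prodMk_left (μ := ν) (ν := expMeasure 1) hS
    (measure_ne_top _ _)
  have hsplit : (ν.prod (expMeasure 1)).real S - (1 - ν.real A + Real.exp (-t) * ∫ y in A, x y ∂ν)
      = ∫ y in A, ((expMeasure 1).real (Prod.mk y ⁻¹' S) - Real.exp (-t) * x y) ∂ν := by
    rw [measureReal_prod_eq_integral _ _ hS, ← integral_add_compl hA hfint,
      setIntegral_congr_fun hA.compl hfiber_compl, setIntegral_const,
      integral_sub hfint.integrableOn (hxint.const_mul _), integral_const_mul,
      probReal_compl_eq_one_sub hA, smul_eq_mul]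
    ring
  have hbound : ∀ y ∈ A, ‖(expMeasure 1).real (Prod.mk y ⁻¹' S) - Real.exp (-t) * x y‖
      ≤ M ^ 2 / 2 := fun y hy => by
    obtain ⟨hx0, hxM'⟩ := hxM y hy
    rw [hfiber y hy]
    exact (abs_expMeasure_one_real_Icc_add_sub_le ht hx0).trans (by gcongr)
  rw [hsplit, ← Real.norm_eq_abs]
  calc _ ≤ M ^ 2 / 2 * ν.real A := norm_setIntegral_le_of_norm_le_const (measure_lt_top ν A) hbound
    _ ≤ M ^ 2 / 2 := mul_le_of_le_one_right (by positivity) measureReal_le_one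

end GammaLaw

attribute [local instance] InnerProductSpace.complexToReal

section Isometry

variable {E : Type*} [NormedAddCommGroup E] [InnerProductSpace ℂ E] [FiniteDimensional ℂ E]

lemma exists_orthonormalBasis_apply_eq {ι : Type*} [Fintype ι]
    (hcard : finrank ℂ E = Fintype.card ι) (i : ι) {v : E} (hv : ‖v‖ = 1) :
    ∃ b : OrthonormalBasis ι ℂ E, b i = v := by
  have hort : Orthonormal ℂ (Set.domRestrict {i} fun _ => v) := by
    classical
    rw [orthonormal_iff_ite]
    rintro ⟨_, rfl⟩ ⟨_, rfl⟩
    simp [Set.domRestrict, hv]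
  obtain ⟨b, hb⟩ := hort.exists_orthonormalBasis_extension_of_card_eq hcard
  exact ⟨b, hb i rfl⟩

lemma exists_linearIsometryEquiv_apply_eq {v w : E} (hv : ‖v‖ = 1) (hw : ‖w‖ = 1) :
    ∃ T : E ≃ₗᵢ[ℂ] E, T v = w := by
  have : Nontrivial E := ⟨⟨v, 0, norm_ne_zero_iff.1 (hv ▸ one_ne_zero)⟩⟩
  have hcard : finrank ℂ E = Fintype.card (Fin (finrank ℂ E)) := (Fintype.card_fin _).symm
  obtain ⟨b, hb⟩ := exists_orthonormalBasis_apply_eq hcard ⟨0, Module.finrank_pos⟩ hv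
  obtain ⟨c, hc⟩ := exists_orthonormalBasis_apply_eq hcard ⟨0, Module.finrank_pos⟩ hw
  refine ⟨b.equiv c (Equiv.refl _), ?_⟩
  rw [← hb, OrthonormalBasis.equiv_apply_basis, Equiv.refl_apply, hc]

end Isometry

section Gaussian

variable (E : Type*) [NormedAddCommGroup E] [InnerProductSpace ℂ E] [FiniteDimensional ℂ E]
  [MeasurableSpace E] [BorelSpace E]

instance finiteDimensional_real_of_complex : FiniteDimensional ℝ E :=
  FiniteDimensional.complexToReal E

/-- The standard complex Gaussian law on a finite-dimensional complex inner product space: the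
coordinates in any orthonormal basis are independent and `CN(0, 1)`. -/
def stdComplexGaussian : Measure E :=
  volume.withDensity fun x => ENNReal.ofReal ((π ^ finrank ℂ E)⁻¹ * Real.exp (-‖x‖ ^ 2))

variable {E}

lemma integral_stdComplexGaussian {G : Type*} [NormedAddCommGroup G] [NormedSpace ℝ G]
    (g : E → G) :
    ∫ x, g x ∂stdComplexGaussian E
      = ∫ x, ((π ^ finrank ℂ E)⁻¹ * Real.exp (-‖x‖ ^ 2)) • g x := by
  rw [stdComplexGaussian, integral_withDensity_eq_integral_toReal_smul (by fun_prop) (by simp)]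
  exact integral_congr_ae (.of_forall fun x => by
    simp only [ENNReal.toReal_ofReal (show 0 ≤ (π ^ finrank ℂ E)⁻¹ * Real.exp (-‖x‖ ^ 2) by
      positivity)])

lemma charFun_stdComplexGaussian (t : E) :
    charFun (stdComplexGaussian E) t = Complex.exp (-‖t‖ ^ 2 / 4) := by
  have hfourier : ∫ x : E, Complex.exp (-‖x‖ ^ 2 + Complex.I * inner ℝ t x)
      = π ^ finrank ℂ E * Complex.exp (-‖t‖ ^ 2 / 4) := by
    simpa [finrank_real_of_complex] using
      GaussianFourier.integral_cexp_neg_mul_sq_norm_add (V := E) (b := 1) (by simp) Complex.I t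
  have hpi : (π : ℂ) ^ finrank ℂ E ≠ 0 := pow_ne_zero _ (by exact_mod_cast Real.pi_ne_zero)
  rw [charFun_apply, integral_stdComplexGaussian, ← mul_right_inj' hpi, ← hfourier,
    ← integral_const_mul]
  refine integral_congr_ae (.of_forall fun x => ?_)
  simp only [Complex.real_smul, Complex.exp_add]
  push_cast
  rw [real_inner_comm, mul_comm Complex.I]
  field_simp

instance isProbabilityMeasure_stdComplexGaussian : IsProbabilityMeasure (stdComplexGaussian E) := by
  have hgauss : ∫ x : E, Real.exp (-‖x‖ ^ 2) = π ^ finrank ℂ E := by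
    simpa [finrank_real_of_complex] using
      GaussianFourier.integral_rexp_neg_mul_sq_norm (V := E) one_pos
  have hpi : 0 < π ^ finrank ℂ E := by positivity
  have hint : Integrable fun x : E => Real.exp (-‖x‖ ^ 2) :=
    .of_integral_ne_zero (hgauss ▸ hpi.ne')
  constructor
  rw [stdComplexGaussian, withDensity_apply _ .univ, Measure.restrict_univ,
    ← ofReal_integral_eq_lintegral_ofReal (hint.const_mul _) (.of_forall fun x => by positivity),
    integral_const_mul, hgauss, inv_mul_cancel₀ hpi.ne', ENNReal.ofReal_one]

variable {F : Type*} [NormedAddCommGroup F] [InnerProductSpace ℂ F] [FiniteDimensional ℂ F]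
  [MeasurableSpace F] [BorelSpace F]

lemma map_stdComplexGaussian_of_isometric_adjoint (T : E →L[ℂ] F) (S : F →ₗᵢ[ℂ] E)
    (hTS : ∀ x y, inner ℂ (T x) y = inner ℂ x (S y)) :
    (stdComplexGaussian E).map T = stdComplexGaussian F := by
  have : IsProbabilityMeasure ((stdComplexGaussian E).map T) :=
    Measure.isProbabilityMeasure_map T.continuous.aemeasurable
  refine Measure.ext_of_charFun (funext fun t => ?_)
  rw [charFun_stdComplexGaussian, charFun_apply,
    integral_map T.continuous.aemeasurable (by fun_prop), ← S.norm_map t,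
    ← charFun_stdComplexGaussian (S t), charFun_apply]
  simp only [real_inner_eq_re_inner ℂ, hTS]

lemma measurePreserving_linearIsometryEquiv (T : E ≃ₗᵢ[ℂ] F) :
    MeasurePreserving T (stdComplexGaussian E) (stdComplexGaussian F) :=
  ⟨T.continuous.measurable, map_stdComplexGaussian_of_isometric_adjoint (T : E →L[ℂ] F)
    T.symm.toLinearIsometry fun x y => by simpa using T.inner_map_map x (T.symm y)⟩

lemma hasLaw_orthogonalProjectionOnto (K : Submodule ℂ E) :
    HasLaw K.orthogonalProjectionOnto (stdComplexGaussian K) (stdComplexGaussian E) :=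
  ⟨K.orthogonalProjectionOnto.continuous.aemeasurable,
    map_stdComplexGaussian_of_isometric_adjoint (F := K) K.orthogonalProjectionOnto K.subtypeₗᵢ
      fun x y => Submodule.inner_orthogonalProjectionOnto_eq_of_mem_right y x⟩

lemma ae_inner_ne_zero {w : E} (hw : w ≠ 0) : ∀ᵐ h ∂stdComplexGaussian E, inner ℂ w h ≠ 0 := by
  have hker : (LinearMap.ker (innerₛₗ ℂ w)).restrictScalars ℝ ≠ ⊤ := fun htop => by
    have hmem : w ∈ (LinearMap.ker (innerₛₗ ℂ w)).restrictScalars ℝ := htop ▸ Submodule.mem_top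
    exact hw (by simpa using hmem)
  refine (withDensity_absolutelyContinuous _ _).ae_le (ae_iff.2 ?_)
  convert Measure.addHaar_submodule volume _ hker using 2
  ext x
  simp

lemma exists_integral_normSq_stdComplexGaussian_eq [Nontrivial E] :
    ∃ K : ℝ, ∀ g : ℝ → ℝ, ∫ x, g (‖x‖ ^ 2) ∂stdComplexGaussian E
      = K * ∫ t, g t ∂gammaMeasure (finrank ℂ E) 1 := by
  have hn : 0 < finrank ℂ E := Module.finrank_pos
  have hn' : (0 : ℝ) < finrank ℂ E := by exact_mod_cast hn
  have hΓ := (Real.Gamma_pos_of_pos hn').ne'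
  refine ⟨finrank ℝ E * volume.real (Metric.ball (0 : E) 1) *
    ((π ^ finrank ℂ E)⁻¹ / 2 * Real.Gamma (finrank ℂ E)), fun g => ?_⟩
  rw [integral_stdComplexGaussian, integral_fun_norm_addHaar volume
      fun r => ((π ^ finrank ℂ E)⁻¹ * Real.exp (-r ^ 2)) • g (r ^ 2),
    integral_gammaMeasure_one hn', nsmul_eq_mul, smul_eq_mul, ← mul_assoc, mul_assoc (_ * _)]
  congr 1
  rw [← integral_comp_rpow_Ioi_of_pos
      (g := fun t => t ^ ((finrank ℂ E : ℝ) - 1) * Real.exp (-t) / Real.Gamma (finrank ℂ E) * g t)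
      two_pos, ← integral_const_mul]
  refine setIntegral_congr_fun measurableSet_Ioi fun r (hr : 0 < r) => ?_
  have hpow : r ^ (finrank ℝ E - 1) = (r ^ 2) ^ ((finrank ℂ E : ℝ) - 1) * r := by
    rw [← Nat.cast_pred hn, Real.rpow_natCast, ← pow_mul, ← pow_succ, finrank_real_of_complex]
    congr 1
    omega
  simp only [smul_eq_mul, Real.rpow_two, hpow, show (2 : ℝ) - 1 = 1 by norm_num, Real.rpow_one]
  field_simp

lemma hasLaw_normSq_stdComplexGaussian [Nontrivial E] :
    HasLaw (fun x : E => ‖x‖ ^ 2) (gammaMeasure (finrank ℂ E) 1) (stdComplexGaussian E) := by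
  have hprob : IsProbabilityMeasure (gammaMeasure (finrank ℂ E) 1) :=
    isProbabilityMeasure_gammaMeasure (by exact_mod_cast Module.finrank_pos) one_pos
  obtain ⟨K, hK⟩ := exists_integral_normSq_stdComplexGaussian_eq (E := E)
  obtain rfl : 1 = K := by simpa using hK fun _ => 1
  refine ⟨by fun_prop, Measure.ext fun s hs => ?_⟩
  rw [← measureReal_eq_measureReal_iff, map_measureReal_apply (by fun_prop) hs,
    ← integral_indicator_one hs, ← integral_indicator_one (hs.preimage (by fun_prop)),
    ← one_mul (∫ _, _ ∂gammaMeasure _ _), ← hK]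
  rfl

section Isotropy

variable {m : Measure E} {Φ : E → ℝ}

lemma integral_mul_normSq_inner_eq_of_norm_eq_one (hm : ∀ T : E ≃ₗᵢ[ℂ] E, MeasurePreserving T m m)
    (hΦ : ∀ (T : E ≃ₗᵢ[ℂ] E) x, Φ (T x) = Φ x) {v w : E} (hv : ‖v‖ = 1) (hw : ‖w‖ = 1) :
    ∫ x, Φ x * ‖inner ℂ v x‖ ^ 2 ∂m = ∫ x, Φ x * ‖inner ℂ w x‖ ^ 2 ∂m := by
  obtain ⟨T, rfl⟩ := exists_linearIsometryEquiv_apply_eq hv hw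
  rw [← (hm T).integral_comp T.toHomeomorph.measurableEmbedding
    fun x => Φ x * ‖inner ℂ (T v) x‖ ^ 2]
  simp only [hΦ, LinearIsometryEquiv.inner_map_map]

lemma integral_mul_normSq_eq_finrank_mul (hm : ∀ T : E ≃ₗᵢ[ℂ] E, MeasurePreserving T m m)
    (hΦm : AEStronglyMeasurable Φ m) (hΦ : ∀ (T : E ≃ₗᵢ[ℂ] E) x, Φ (T x) = Φ x)
    (hint : Integrable (fun x => Φ x * ‖x‖ ^ 2) m) {v : E} (hv : ‖v‖ = 1) :
    ∫ x, Φ x * ‖x‖ ^ 2 ∂m = finrank ℂ E * ∫ x, Φ x * ‖inner ℂ v x‖ ^ 2 ∂m := by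
  let b := stdOrthonormalBasis ℂ E
  have hbint : ∀ i, Integrable (fun x => Φ x * ‖inner ℂ (b i) x‖ ^ 2) m := fun i => by
    refine hint.mono (by fun_prop) (.of_forall fun x => ?_)
    have hinner := norm_inner_le_norm (𝕜 := ℂ) (b i) x
    rw [b.norm_eq_one, one_mul] at hinner
    simp only [norm_mul, norm_pow, norm_norm]
    gcongr
  calc ∫ x, Φ x * ‖x‖ ^ 2 ∂m
      = ∫ x, ∑ i, Φ x * ‖inner ℂ (b i) x‖ ^ 2 ∂m := by
        simp only [← Finset.mul_sum, b.sum_sq_norm_inner_right]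
    _ = ∑ i, ∫ x, Φ x * ‖inner ℂ (b i) x‖ ^ 2 ∂m := integral_finsetSum _ fun i _ => hbint i
    _ = finrank ℂ E * ∫ x, Φ x * ‖inner ℂ v x‖ ^ 2 ∂m := by
        simp only [integral_mul_normSq_inner_eq_of_norm_eq_one hm hΦ (b.norm_eq_one _) hv,
          Finset.sum_const, Finset.card_univ, Fintype.card_fin, nsmul_eq_mul]

lemma integral_mul_normSq_inner (hm : ∀ T : E ≃ₗᵢ[ℂ] E, MeasurePreserving T m m)
    (hΦm : AEStronglyMeasurable Φ m) (hΦ : ∀ (T : E ≃ₗᵢ[ℂ] E) x, Φ (T x) = Φ x)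
    (hint : Integrable (fun x => Φ x * ‖x‖ ^ 2) m) (w : E) :
    ∫ x, Φ x * ‖inner ℂ w x‖ ^ 2 ∂m = ‖w‖ ^ 2 / finrank ℂ E * ∫ x, Φ x * ‖x‖ ^ 2 ∂m := by
  rcases eq_or_ne w 0 with rfl | hw
  · simp
  have : Nontrivial E := ⟨⟨w, 0, hw⟩⟩
  have hn : (finrank ℂ E : ℝ) ≠ 0 := by exact_mod_cast Module.finrank_pos.ne'
  have hv : ‖((‖w‖⁻¹ : ℝ) : ℂ) • w‖ = 1 := by simp [norm_smul, hw]
  have hscale : ∀ x, ‖inner ℂ w x‖ ^ 2 = ‖w‖ ^ 2 * ‖inner ℂ (((‖w‖⁻¹ : ℝ) : ℂ) • w) x‖ ^ 2 :=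
    fun x => by
      have hw' : ‖w‖ ≠ 0 := norm_ne_zero_iff.2 hw
      simp only [inner_smul_left, norm_mul, RCLike.norm_conj, Complex.norm_real, norm_inv,
        norm_norm]
      field_simp
  rw [integral_mul_normSq_eq_finrank_mul hm hΦm hΦ hint hv]
  simp only [hscale, mul_left_comm _ (‖w‖ ^ 2), integral_const_mul]
  field_simp

end Isotropy

lemma integral_mul_normSq_inner_stdComplexGaussian [Nontrivial E] {ψ : ℝ → ℝ} (hψ : Measurable ψ)
    (hint : Integrable (fun t => ψ t * t) (gammaMeasure (finrank ℂ E) 1)) (w : E) :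
    ∫ x, ψ (‖x‖ ^ 2) * ‖inner ℂ w x‖ ^ 2 ∂stdComplexGaussian E
      = ‖w‖ ^ 2 / finrank ℂ E * ∫ t, ψ t * t ∂gammaMeasure (finrank ℂ E) 1 := by
  have hlaw := hasLaw_normSq_stdComplexGaussian (E := E)
  rw [← hlaw.map_eq] at hint
  rw [← hlaw.integral_comp (f := fun t => ψ t * t) (by fun_prop)]
  exact integral_mul_normSq_inner (Φ := fun x => ψ (‖x‖ ^ 2)) measurePreserving_linearIsometryEquiv
    (hψ.comp (by fun_prop)).aestronglyMeasurable (fun T x => by rw [T.norm_map])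
    (hint.comp_aemeasurable hlaw.aemeasurable) w

lemma setIntegral_normSq_inner_div_stdComplexGaussian [Nontrivial E] {a : ℝ} (ha : 0 < a) (w : E) :
    ∫ x in {x | a < ‖x‖ ^ 2}, ‖inner ℂ w x‖ ^ 2 / (‖x‖ ^ 2) ^ 2 ∂stdComplexGaussian E
      = ‖w‖ ^ 2 / finrank ℂ E *
        (upperGamma (finrank ℂ E - 1) a / Real.Gamma (finrank ℂ E)) := by
  have hn : (0 : ℝ) < finrank ℂ E := by exact_mod_cast Module.finrank_pos
  have hprob := isProbabilityMeasure_gammaMeasure hn one_pos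
  let ψ : ℝ → ℝ := (Set.Ioi a).indicator fun t => (t ^ 2)⁻¹
  have hψ : Measurable ψ :=
    (by fun_prop : Measurable fun t : ℝ => (t ^ 2)⁻¹).indicator measurableSet_Ioi
  have hψmul : (fun t => ψ t * t) = (Set.Ioi a).indicator fun t => t ^ (-1 : ℝ) := by
    ext t
    by_cases hat : t ∈ Set.Ioi a
    · have ht : t ≠ 0 := (ha.trans hat).ne'
      simp only [ψ, Set.indicator_of_mem hat, Real.rpow_neg_one]
      field_simp
    · simp only [ψ, Set.indicator_of_notMem hat, zero_mul]
  have hint : Integrable (fun t => ψ t * t) (gammaMeasure (finrank ℂ E) 1) := by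
    rw [hψmul, integrable_indicator_iff measurableSet_Ioi]
    refine Integrable.of_bound (by fun_prop) a⁻¹ ?_
    filter_upwards [ae_restrict_mem measurableSet_Ioi] with t (hat : a < t)
    rw [Real.rpow_neg_one, norm_inv, Real.norm_of_nonneg (ha.trans hat).le]
    gcongr
  have hintegrand : ∀ x : E, {x | a < ‖x‖ ^ 2}.indicator
      (fun x => ‖inner ℂ w x‖ ^ 2 / (‖x‖ ^ 2) ^ 2) x = ψ (‖x‖ ^ 2) * ‖inner ℂ w x‖ ^ 2 := by
    intro x
    simp only [ψ, Set.indicator, Set.mem_ofPred_eq, Set.mem_Ioi]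
    split_ifs <;> ring
  rw [← integral_indicator (measurableSet_lt (by fun_prop) (by fun_prop)),
    integral_congr_ae (.of_forall hintegrand),
    integral_mul_normSq_inner_stdComplexGaussian hψ hint, hψmul,
    integral_indicator measurableSet_Ioi, setIntegral_rpow_gammaMeasure hn ha.le, ← sub_eq_add_neg]

end Gaussian

section Perp

variable {E : Type*} [NormedAddCommGroup E] [InnerProductSpace ℂ E]

/-- The component of `h` orthogonal to `u`, for a unit vector `u`.  An explicit formula makes it
jointly measurable in `(u, h)`. -/
def perp (u h : E) : E := h - inner ℂ u h • u

lemma perp_smul (u h : E) (c : ℂ) : perp u (c • h) = c • perp u h := by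
  simp only [perp, inner_smul_right, smul_sub, smul_smul]

lemma inner_left_perp {u : E} (h : E) (hu : ‖u‖ = 1) : inner ℂ u (perp u h) = 0 := by
  rw [perp, inner_sub_right, inner_smul_right, inner_self_eq_norm_sq_to_K, hu]
  simp

lemma inner_perp_left (u s h : E) : inner ℂ (perp u s) h = inner ℂ s (perp u h) := by
  rw [perp, perp, inner_sub_left, inner_sub_right, inner_smul_left, inner_smul_right,
    inner_conj_symm, mul_comm]

lemma inner_perp_right {u : E} (s h : E) (hu : ‖u‖ = 1) :
    inner ℂ s (perp u h) = inner ℂ (perp u s) (perp u h) := by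
  conv_rhs => rw [perp, inner_sub_left, inner_smul_left, inner_left_perp h hu]
  rw [mul_zero, sub_zero]

lemma norm_perp_sq {u : E} (h : E) (hu : ‖u‖ = 1) :
    ‖perp u h‖ ^ 2 = ‖h‖ ^ 2 - ‖inner ℂ u h‖ ^ 2 := by
  have hort : inner ℂ (perp u h) (inner ℂ u h • u) = 0 := by
    rw [inner_smul_right, inner_eq_zero_symm.1 (inner_left_perp h hu), mul_zero]
  have hpyth := norm_add_sq_eq_norm_sq_add_norm_sq_of_inner_eq_zero _ _ hort
  rw [perp, sub_add_cancel, ← perp, norm_smul, hu, mul_one] at hpyth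
  linarith

lemma coe_orthogonalProjectionOnto_eq_perp {u : E} (hu : ‖u‖ = 1) (h : E) :
    ((ℂ ∙ u)ᗮ.orthogonalProjectionOnto h : E) = perp u h := by
  rw [← Submodule.starProjection_apply, Submodule.starProjection_orthogonal_val,
    Submodule.starProjection_unit_singleton ℂ hu, perp]

lemma finrank_orthogonal_span_singleton_eq_sub_one [FiniteDimensional ℂ E] {u : E} (hu : ‖u‖ = 1) :
    finrank ℂ (ℂ ∙ u)ᗮ = finrank ℂ E - 1 := by
  have hadd := Submodule.finrank_add_finrank_orthogonal (ℂ ∙ u)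
  rw [finrank_span_singleton (norm_ne_zero_iff.1 (hu ▸ one_ne_zero))] at hadd
  omega

lemma nontrivial_orthogonal_span_singleton [FiniteDimensional ℂ E] {u : E} (hu : ‖u‖ = 1)
    (hE : 1 < finrank ℂ E) : Nontrivial (ℂ ∙ u)ᗮ := by
  refine Module.nontrivial_of_finrank_pos (R := ℂ) ?_
  rw [finrank_orthogonal_span_singleton_eq_sub_one hu]
  omega

/-- The interference leaked through the orthogonal beam: for a cross channel `s`, a quantized
direction `u` and a secondary channel `h`, it is `|s† h_⊥|² / ‖h_⊥‖⁴` with `h_⊥ = perp u h`, so that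
serving `h` with receive power `P` along `h_⊥` causes the interference `P * leakage s u h`. -/
def leakage (s u h : E) : ℝ := ‖inner ℂ s (perp u h)‖ ^ 2 / (‖perp u h‖ ^ 2) ^ 2

lemma leakage_nonneg (s u h : E) : 0 ≤ leakage s u h := by
  unfold leakage
  positivity

lemma leakage_mul_le_normSq_perp {u : E} (s h : E) (hu : ‖u‖ = 1) :
    leakage s u h * ‖perp u h‖ ^ 2 ≤ ‖perp u s‖ ^ 2 := by
  have hcs : ‖inner ℂ s (perp u h)‖ ^ 2 ≤ ‖perp u s‖ ^ 2 * ‖perp u h‖ ^ 2 := by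
    rw [inner_perp_right s h hu, ← mul_pow]
    gcongr
    exact norm_inner_le_norm _ _
  rcases (sq_nonneg ‖perp u h‖).eq_or_lt with hzero | hpos
  · rw [← hzero, mul_zero]
    positivity
  · rwa [leakage, div_mul_eq_mul_div, div_le_iff₀ (by positivity), sq (‖perp u h‖ ^ 2), ← mul_assoc,
      mul_le_mul_iff_left₀ hpos]

variable [MeasurableSpace E] [BorelSpace E] [SecondCountableTopology E]

@[fun_prop]
lemma measurable_perp {α : Type*} [MeasurableSpace α] {u h : α → E} (hu : Measurable u)
    (hh : Measurable h) : Measurable fun x => perp (u x) (h x) := by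
  unfold perp
  fun_prop

@[fun_prop]
lemma measurable_leakage {α : Type*} [MeasurableSpace α] {s u h : α → E} (hs : Measurable s)
    (hu : Measurable u) (hh : Measurable h) : Measurable fun x => leakage (s x) (u x) (h x) := by
  unfold leakage
  fun_prop

/-- The set of pairs `(h, g)` of a secondary channel and a primary gain for which the secondary link
is in outage: either full power is not enough (`a` is the required gain of `perp u h`), or `g`
exceeds the threshold `t` of primary outage by too little for the interference to be admissible. -/
def outageRegion (a t c : ℝ) (s u : E) : Set (E × ℝ) :=
  {q | ‖perp u q.1‖ ^ 2 ≤ a ∨ q.2 ∈ Set.Icc t (t + c * leakage s u q.1)}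

lemma measurableSet_outageRegion (a t c : ℝ) :
    MeasurableSet {q : (E × E) × E × ℝ | q.2 ∈ outageRegion a t c q.1.1 q.1.2} := by
  simp only [outageRegion, Set.mem_ofPred_eq, Set.mem_Icc]
  measurability

end Perp

section Expansion

variable {E : Type*} [NormedAddCommGroup E] [InnerProductSpace ℂ E] [FiniteDimensional ℂ E]
  [MeasurableSpace E] [BorelSpace E]

lemma ae_inner_perp_ne_zero {u s : E} (hs : perp u s ≠ 0) :
    ∀ᵐ h ∂stdComplexGaussian E, inner ℂ s (perp u h) ≠ 0 := by
  simpa only [inner_perp_left] using ae_inner_ne_zero hs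

lemma hasLaw_normSq_perp {u : E} (hu : ‖u‖ = 1) (hE : 1 < finrank ℂ E) :
    HasLaw (fun h => ‖perp u h‖ ^ 2) (gammaMeasure (finrank ℂ E - 1) 1) (stdComplexGaussian E) := by
  have := nontrivial_orthogonal_span_singleton hu hE
  have hlaw := hasLaw_normSq_stdComplexGaussian.comp (hasLaw_orthogonalProjectionOnto (ℂ ∙ u)ᗮ)
  rw [finrank_orthogonal_span_singleton_eq_sub_one hu, Nat.cast_pred (by omega)] at hlaw
  refine hlaw.congr (.of_forall fun h => ?_)
  simp only [Function.comp_apply, ← coe_orthogonalProjectionOnto_eq_perp hu, Submodule.coe_norm]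

lemma setIntegral_leakage_stdComplexGaussian {u : E} (hu : ‖u‖ = 1) (hE : 1 < finrank ℂ E) {a : ℝ}
    (ha : 0 < a) (s : E) :
    ∫ h in {h | a < ‖perp u h‖ ^ 2}, leakage s u h ∂stdComplexGaussian E
      = ‖perp u s‖ ^ 2 / (finrank ℂ E - 1) *
        (upperGamma (finrank ℂ E - 2) a / Real.Gamma (finrank ℂ E - 1)) := by
  have := nontrivial_orthogonal_span_singleton hu hE
  have hlaw := hasLaw_orthogonalProjectionOnto (E := E) (ℂ ∙ u)ᗮ
  have hcast : (finrank ℂ (ℂ ∙ u)ᗮ : ℝ) = finrank ℂ E - 1 := by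
    rw [finrank_orthogonal_span_singleton_eq_sub_one hu, Nat.cast_pred (by omega)]
  have hproj := setIntegral_normSq_inner_div_stdComplexGaussian ha
    ((ℂ ∙ u)ᗮ.orthogonalProjectionOnto s)
  rw [← hlaw.map_eq, setIntegral_map (measurableSet_lt (by fun_prop) (by fun_prop))
    (Measurable.aestronglyMeasurable (by fun_prop)) hlaw.aemeasurable] at hproj
  simp only [Set.preimage_ofPred_eq, Submodule.coe_norm, Submodule.coe_inner,
    coe_orthogonalProjectionOnto_eq_perp hu, ← inner_perp_right s _ hu, hcast, sub_sub,
    one_add_one_eq_two] at hproj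
  exact hproj

lemma measureReal_lt_normSq_perp {u : E} (hu : ‖u‖ = 1) (hE : 1 < finrank ℂ E) {a : ℝ}
    (ha : 0 ≤ a) : (stdComplexGaussian E).real {h | a < ‖perp u h‖ ^ 2}
      = upperGamma (finrank ℂ E - 1) a / Real.Gamma (finrank ℂ E - 1) := by
  have hpos : (0 : ℝ) < finrank ℂ E - 1 := sub_pos.2 (by exact_mod_cast hE)
  rw [← gammaMeasure_real_Ioi hpos ha]
  exact (hasLaw_normSq_perp hu hE).measureReal_eq measurableSet_Ioi

lemma abs_measureReal_outageRegion_sub_le {u : E} (hu : ‖u‖ = 1) (hE : 1 < finrank ℂ E)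
    {a t c : ℝ} (ha : 0 < a) (ht : 0 ≤ t) (hc : 0 ≤ c) (s : E) :
    |((stdComplexGaussian E).prod (expMeasure 1)).real (outageRegion a t c s u) -
      (1 - upperGamma (finrank ℂ E - 1) a / Real.Gamma (finrank ℂ E - 1) +
        Real.exp (-t) * (c * (‖perp u s‖ ^ 2 / (finrank ℂ E - 1) *
          (upperGamma (finrank ℂ E - 2) a / Real.Gamma (finrank ℂ E - 1)))))|
      ≤ (c * ‖perp u s‖ ^ 2 / a) ^ 2 / 2 := by
  set A : Set E := {h | a < ‖perp u h‖ ^ 2} with hA_def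
  have hA : MeasurableSet A := measurableSet_lt (by fun_prop) (by fun_prop)
  have hbound : ∀ h ∈ A, c * leakage s u h ∈ Set.Icc 0 (c * ‖perp u s‖ ^ 2 / a) :=
    fun h (hah : a < _) => by
      refine ⟨mul_nonneg hc (leakage_nonneg s u h), ?_⟩
      rw [mul_div_assoc]
      gcongr
      rw [le_div_iff₀ ha]
      refine le_trans ?_ (leakage_mul_le_normSq_perp s h hu)
      gcongr
      exact leakage_nonneg s u h
  have hregion : outageRegion a t c s u
      = {q | q.1 ∉ A ∨ q.2 ∈ Set.Icc t (t + c * leakage s u q.1)} := by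
    simp only [outageRegion, hA_def, Set.mem_ofPred_eq, not_lt]
  rw [← measureReal_lt_normSq_perp hu hE ha.le, ← setIntegral_leakage_stdComplexGaussian hu hE ha s,
    ← integral_const_mul, hregion]
  exact abs_measureReal_prod_expMeasure_sub_le (stdComplexGaussian E) hA
    (x := fun h => c * leakage s u h) (by fun_prop) ht hbound

end Expansion

section Shape

variable {L : ℕ}

lemma norm_shape {h : CVec L} (hh : h ≠ 0) : ‖shape h‖ = 1 := by
  simp [shape, norm_smul, hh]

lemma norm_shape_le_one (h : CVec L) : ‖shape h‖ ≤ 1 := by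
  rcases eq_or_ne h 0 with rfl | hh
  · simp [shape]
  · exact (norm_shape hh).le

lemma norm_smul_shape (h : CVec L) : (‖h‖ : ℂ) • shape h = h := by
  rcases eq_or_ne h 0 with rfl | hh
  · simp
  · rw [shape, Complex.ofReal_inv, smul_inv_smul₀ (by simpa using hh)]

lemma shape_smul {c : ℝ} (hc : 0 < c) (h : CVec L) : shape ((c : ℂ) • h) = shape h := by
  have hc' : (c : ℂ) ≠ 0 := by exact_mod_cast hc.ne'
  rw [shape, shape, smul_smul, norm_smul, Complex.norm_real, Real.norm_of_nonneg hc.le]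
  congr 1
  push_cast
  field_simp

@[fun_prop]
lemma measurable_shape : Measurable (shape : CVec L → CVec L) := by
  unfold shape
  fun_prop

lemma norm_inner_shape_self (h : CVec L) : ‖inner ℂ (shape h) h‖ = ‖h‖ := by
  rcases eq_or_ne h 0 with rfl | hh
  · simp
  · rw [shape, inner_smul_left, inner_self_eq_norm_sq_to_K]
    simp [sq, hh]

lemma normSq_mul_normSq_inner_shape_right (v h : CVec L) :
    ‖h‖ ^ 2 * ‖inner ℂ v (shape h)‖ ^ 2 = ‖inner ℂ v h‖ ^ 2 := by
  conv_rhs => rw [← norm_smul_shape h, inner_smul_right]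
  simp [mul_pow]

lemma normSq_mul_normSq_inner_shape_left (v h : CVec L) :
    ‖h‖ ^ 2 * ‖inner ℂ (shape h) v‖ ^ 2 = ‖inner ℂ h v‖ ^ 2 := by
  rw [norm_inner_symm, normSq_mul_normSq_inner_shape_right, norm_inner_symm]

variable {u : CVec L}

lemma normSq_mul_normSq_perp_shape (u h : CVec L) :
    ‖h‖ ^ 2 * ‖perp u (shape h)‖ ^ 2 = ‖perp u h‖ ^ 2 := by
  conv_rhs => rw [← norm_smul_shape h, perp_smul, norm_smul]
  simp [mul_pow]

lemma perpDir_shape (u h : CVec L) : perpDir u (shape h) = shape (perp u h) := by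
  rcases eq_or_ne h 0 with rfl | hh
  · simp [perpDir, shape, perp]
  · rw [perpDir, ← perp, shape.eq_def h, perp_smul, shape_smul (by positivity)]

lemma normSq_mul_cdiError_shape (hu : ‖u‖ = 1) (h : CVec L) :
    ‖h‖ ^ 2 * cdiError u (shape h) = ‖perp u h‖ ^ 2 := by
  rw [cdiError, mul_sub, mul_one, normSq_mul_normSq_inner_shape_right, norm_perp_sq h hu]

end Shape

section Beamformer

variable {L : ℕ} {u s v f : CVec L} {P : ℝ}

lemma normSq_inner_le_mul_normSq_perp (hv : inner ℂ v u = 0) (hvP : ‖v‖ ^ 2 ≤ P) :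
    ‖inner ℂ v s‖ ^ 2 ≤ P * ‖perp u s‖ ^ 2 := by
  have hperp : inner ℂ v s = inner ℂ v (perp u s) := by
    rw [perp, inner_sub_right, inner_smul_right, hv, mul_zero, sub_zero]
  calc ‖inner ℂ v s‖ ^ 2 ≤ (‖v‖ * ‖perp u s‖) ^ 2 := by
        rw [hperp]
        gcongr
        exact norm_inner_le_norm _ _
    _ ≤ P * ‖perp u s‖ ^ 2 := by
        rw [mul_pow]
        gcongr

lemma exists_normSq_inner_eq_mul_normSq_perp (hu : ‖u‖ = 1) (hP : 0 ≤ P) (s : CVec L) :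
    ∃ v : CVec L, (inner ℂ v u = 0 ∧ ‖v‖ ^ 2 ≤ P) ∧ ‖inner ℂ v s‖ ^ 2 = P * ‖perp u s‖ ^ 2 := by
  have hort : inner ℂ (shape (perp u s)) u = 0 := by
    rw [shape, inner_smul_left, inner_eq_zero_symm.1 (inner_left_perp s hu), mul_zero]
  have hinner : inner ℂ (shape (perp u s)) s = inner ℂ (shape (perp u s)) (perp u s) := by
    conv_rhs => rw [perp, inner_sub_right, inner_smul_right, ← perp, hort]
    rw [mul_zero, sub_zero]
  have hsqrt : ‖(√P : ℂ)‖ ^ 2 = P := by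
    rw [Complex.norm_real, Real.norm_of_nonneg (Real.sqrt_nonneg P), Real.sq_sqrt hP]
  refine ⟨(√P : ℂ) • shape (perp u s), ⟨?_, ?_⟩, ?_⟩
  · rw [inner_smul_left, hort, mul_zero]
  · rw [norm_smul, mul_pow, hsqrt]
    exact mul_le_of_le_one_right hP (pow_le_one₀ (norm_nonneg _) (norm_shape_le_one _))
  · rw [inner_smul_left, norm_mul, RCLike.norm_conj, mul_pow, hsqrt, hinner, norm_inner_shape_self]

lemma IsOCB.normSq_inner_eq (hu : ‖u‖ = 1) (hP : 0 ≤ P) (hf : IsOCB u s P f) :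
    ‖inner ℂ f s‖ ^ 2 = P * ‖perp u s‖ ^ 2 := by
  obtain ⟨⟨hfu, hfP⟩, hmax⟩ := hf
  obtain ⟨v, hv, hvs⟩ := exists_normSq_inner_eq_mul_normSq_perp hu hP s
  exact (normSq_inner_le_mul_normSq_perp hfu hfP).antisymm (hvs ▸ hmax hv)

end Beamformer

section Outage

variable {p : Params} {hp : ℂ} {hx u hs f : CVec p.L}

lemma margin_nonneg_iff (hthetaP : 0 < p.thetaP) (hgammaP : 0 < p.gammaP) (hnoise : 0 < p.noise)
    {g : ℝ} : 0 ≤ margin p g ↔ p.thetaP / p.gammaP ≤ g := by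
  rw [margin, mul_nonneg_iff_of_pos_left hnoise, sub_nonneg, one_le_div hthetaP,
    div_le_iff₀' hgammaP]

lemma powerBudget_nonneg (hlam : 0 < p.lam) (hPmax : 0 < p.Pmax) (hp : ℂ) (hx u hs : CVec p.L) :
    0 ≤ powerBudget p hp hx u hs := by
  refine le_min ?_ hPmax.le
  rw [ipcFeedforward]
  split_ifs with hmargin <;> positivity

lemma IsOCB.snrS_eq (hlam : 0 < p.lam) (hPmax : 0 < p.Pmax) (hu : ‖u‖ = 1)
    (hf : IsOCB u (shape hs) (powerBudget p hp hx u hs) f) :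
    snrS p hs f = powerBudget p hp hx u hs * (‖perp u hs‖ ^ 2 / p.noise) := by
  rw [snrS, hf.normSq_inner_eq hu (powerBudget_nonneg hlam hPmax hp hx u hs),
    ← normSq_mul_normSq_perp_shape u hs]
  ring

lemma lam_mul_normSq_inner_shape_perpDir (hlam : p.lam ≠ 0) (hx u hs : CVec p.L) :
    p.lam * (‖hx‖ ^ 2 / p.lam) * ‖inner ℂ (shape hx) (perpDir u (shape hs))‖ ^ 2
      = leakage hx u hs * ‖perp u hs‖ ^ 2 := by
  rw [mul_div_cancel₀ _ hlam, normSq_mul_normSq_inner_shape_left, perpDir_shape, leakage,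
    ← normSq_mul_normSq_inner_shape_right hx (perp u hs)]
  rcases eq_or_ne (perp u hs) 0 with hzero | hne
  · simp [hzero, shape]
  · have hnorm : ‖perp u hs‖ ≠ 0 := norm_ne_zero_iff.2 hne
    field_simp

lemma ipcFeedforward_mul_le_iff (hlam : 0 < p.lam) (hthetaP : 0 < p.thetaP)
    (hgammaP : 0 < p.gammaP) (hnoise : 0 < p.noise) (hne : inner ℂ hx (perp u hs) ≠ 0)
    (hmargin : 0 ≤ margin p (‖hp‖ ^ 2)) :
    ipcFeedforward p hp hx u hs * (‖perp u hs‖ ^ 2 / p.noise) ≤ p.thetaS ↔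
      ‖hp‖ ^ 2 ≤ p.thetaP / p.gammaP + p.thetaP / p.gammaP * p.thetaS * leakage hx u hs := by
  have hperp : 0 < ‖perp u hs‖ := by
    have hperp_ne : perp u hs ≠ 0 := fun hzero => hne (by rw [hzero, inner_zero_right])
    positivity
  have hleak : 0 < leakage hx u hs := by
    unfold leakage
    positivity
  have hscaled : ipcFeedforward p hp hx u hs * (‖perp u hs‖ ^ 2 / p.noise)
      = (p.gammaP * ‖hp‖ ^ 2 / p.thetaP - 1) / leakage hx u hs := by
    have hipc : ipcFeedforward p hp hx u hs
        = margin p (‖hp‖ ^ 2) / (leakage hx u hs * ‖perp u hs‖ ^ 2) := by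
      rw [← lam_mul_normSq_inner_shape_perpDir hlam.ne']
      exact if_pos hmargin
    rw [hipc, margin]
    field_simp
  rw [hscaled, div_le_iff₀ hleak, sub_le_iff_le_add', div_le_iff₀ hthetaP, ← le_div_iff₀' hgammaP]
  refine iff_of_eq (congrArg (‖hp‖ ^ 2 ≤ ·) ?_)
  field_simp

lemma snrS_le_iff_mem_outageRegion (hlam : 0 < p.lam) (hthetaP : 0 < p.thetaP)
    (hPp : 0 < p.Pp) (hPmax : 0 < p.Pmax) (hnoise : 0 < p.noise) (hu : ‖u‖ = 1)
    (hne : inner ℂ hx (perp u hs) ≠ 0)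
    (hf : IsOCB u (shape hs) (powerBudget p hp hx u hs) f) :
    snrS p hs f ≤ p.thetaS ↔ (hs, ‖hp‖ ^ 2) ∈ outageRegion (p.thetaS / p.gammaMax)
      (p.thetaP / p.gammaP) (p.thetaP / p.gammaP * p.thetaS) hx u := by
  have hgammaP : 0 < p.gammaP := div_pos hPp hnoise
  have hgammaMax : 0 < p.gammaMax := div_pos hPmax hnoise
  have hfull : p.Pmax * (‖perp u hs‖ ^ 2 / p.noise) ≤ p.thetaS ↔
      ‖perp u hs‖ ^ 2 ≤ p.thetaS / p.gammaMax := by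
    rw [le_div_iff₀' hgammaMax, Params.gammaMax, div_mul_eq_mul_div, mul_div_assoc]
  rw [hf.snrS_eq hlam hPmax hu, powerBudget]
  simp only [outageRegion, Set.mem_ofPred_eq, Set.mem_Icc,
    ← margin_nonneg_iff hthetaP hgammaP hnoise]
  by_cases hmargin : 0 ≤ margin p (‖hp‖ ^ 2)
  · rw [min_mul_of_nonneg _ _ (by positivity), min_le_iff, hfull, or_comm,
      ipcFeedforward_mul_le_iff hlam hthetaP hgammaP hnoise hne hmargin, and_iff_right hmargin]
  · have hipc : ipcFeedforward p hp hx u hs = p.Pmax := if_neg hmargin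
    rw [hipc, min_self, hfull, or_iff_left fun h => hmargin h.1]

end Outage

section ChannelLaws

instance isProbabilityMeasure_complexGaussian (v : ℝ) :
    IsProbabilityMeasure (complexGaussian v) :=
  Measure.isProbabilityMeasure_map Complex.measurableEquivRealProd.symm.measurable.aemeasurable

lemma charFun_complexGaussian {v : ℝ} (hv : 0 ≤ v) (t : ℂ) :
    charFun (complexGaussian v) t = Complex.exp (-v * ‖t‖ ^ 2 / 4) := by
  have hfactor (x : ℝ × ℝ) :
      Complex.exp ((inner ℝ (Complex.measurableEquivRealProd.symm x) t : ℝ) * Complex.I)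
        = Complex.exp (t.re * x.1 * Complex.I) * Complex.exp (t.im * x.2 * Complex.I) := by
    have hinner : inner ℝ (Complex.measurableEquivRealProd.symm x) t
        = t.re * x.1 + t.im * x.2 := by
      simp [Complex.measurableEquivRealProd_symm_apply, Complex.inner]
    rw [← Complex.exp_add, hinner, ← add_mul]
    norm_cast
  have hgaussian (r : ℝ) : ∫ x : ℝ, Complex.exp (r * x * Complex.I)
      ∂gaussianReal 0 (v / 2).toNNReal = Complex.exp (-(v / 2 * r ^ 2 / 2)) := by
    rw [← charFun_apply_real, charFun_gaussianReal, Real.coe_toNNReal _ (by positivity)]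
    simp
  have hnorm : (‖t‖ : ℂ) ^ 2 = t.re ^ 2 + t.im ^ 2 := by
    exact_mod_cast (Complex.sq_norm t).trans (by rw [Complex.normSq_apply, sq, sq])
  rw [charFun_apply, complexGaussian, integral_map_equiv]
  simp only [hfactor]
  rw [integral_prod_mul (fun x : ℝ => Complex.exp (t.re * x * Complex.I))
    fun y : ℝ => Complex.exp (t.im * y * Complex.I), hgaussian, hgaussian, ← Complex.exp_add, hnorm]
  congr 1
  ring

lemma complexGaussian_one : complexGaussian 1 = stdComplexGaussian ℂ := by
  refine Measure.ext_of_charFun (funext fun t => ?_)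
  rw [charFun_complexGaussian zero_le_one, charFun_stdComplexGaussian]
  simp

variable {Ω : Type*} [MeasurableSpace Ω] {μ : Measure Ω}

lemma hasLaw_normSq_of_hasLaw_complexGaussian_one {Z : Ω → ℂ}
    (hZ : HasLaw Z (complexGaussian 1) μ) : HasLaw (fun ω => ‖Z ω‖ ^ 2) (expMeasure 1) μ := by
  have hnormSq : HasLaw (fun z : ℂ => ‖z‖ ^ 2) (expMeasure 1) (complexGaussian 1) := by
    simpa [complexGaussian_one] using! hasLaw_normSq_stdComplexGaussian (E := ℂ)
  exact hnormSq.comp hZ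

lemma charFun_map_eq_prod_of_iIndepFun {ι : Type*} [Fintype ι] {h : Ω → EuclideanSpace ℂ ι}
    (hind : iIndepFun (fun i ω => h ω i) μ) (hm : AEMeasurable h μ) (t : EuclideanSpace ℂ ι) :
    charFun (μ.map h) t = ∏ i, charFun (μ.map fun ω => h ω i) (t i) := by
  have hentry (i : ι) : AEMeasurable (fun ω => h ω i) μ := by fun_prop
  have hfactor (ω : Ω) : Complex.exp ((inner ℝ (h ω) t : ℝ) * Complex.I)
      = ∏ i, Complex.exp ((inner ℝ (h ω i) (t i) : ℝ) * Complex.I) := by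
    rw [← Complex.exp_sum, ← Finset.sum_mul, ← Complex.ofReal_sum, real_inner_eq_re_inner ℂ,
      PiLp.inner_apply, map_sum]
    simp only [real_inner_eq_re_inner ℂ]
  simp only [charFun_apply]
  rw [integral_map hm (by fun_prop)]
  simp only [hfactor]
  rw [hind.integral_fun_prod_comp (f := fun i z => Complex.exp ((inner ℝ z (t i) : ℝ) * Complex.I))
    hentry fun i => Continuous.aestronglyMeasurable (by fun_prop)]
  refine Finset.prod_congr rfl fun i _ => ?_
  rw [integral_map (hentry i) (Continuous.aestronglyMeasurable (by fun_prop))]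

namespace IsIIDComplexGaussian

variable {L : ℕ} {v : ℝ} {h : Ω → CVec L}

lemma aemeasurable (hh : IsIIDComplexGaussian μ v h) : AEMeasurable h μ :=
  (WithLp.measurable_toLp 2 _).comp_aemeasurable
    (aemeasurable_pi_lambda (fun ω i => h ω i) fun i => (hh.2 i).aemeasurable)

lemma charFun_map (hh : IsIIDComplexGaussian μ v h) (hv : 0 ≤ v) (t : CVec L) :
    charFun (μ.map h) t = Complex.exp (-v * ‖t‖ ^ 2 / 4) := by
  rw [charFun_map_eq_prod_of_iIndepFun hh.1 hh.aemeasurable, ← Complex.ofReal_pow,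
    EuclideanSpace.norm_sq_eq]
  simp only [(hh.2 _).map_eq, charFun_complexGaussian hv]
  rw [← Complex.exp_sum]
  push_cast
  rw [Finset.mul_sum, Finset.sum_div]

lemma hasLaw_inv_sqrt_smul [IsFiniteMeasure μ] (hh : IsIIDComplexGaussian μ v h) (hv : 0 < v) :
    HasLaw (fun ω => (√v)⁻¹ • h ω) (stdComplexGaussian (CVec L)) μ where
  aemeasurable := hh.aemeasurable.const_smul (√v)⁻¹
  map_eq := by
    refine Measure.ext_of_charFun (funext fun t => ?_)
    have hnorm : (v : ℂ) * ‖(√v)⁻¹ • t‖ ^ 2 = ‖t‖ ^ 2 := by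
      rw [norm_smul, norm_inv, Real.norm_of_nonneg (Real.sqrt_nonneg v)]
      norm_cast
      rw [mul_pow, inv_pow, Real.sq_sqrt hv.le, mul_inv_cancel_left₀ hv.ne']
    rw [charFun_map_smul_comp hh.aemeasurable, hh.charFun_map hv.le, charFun_stdComplexGaussian,
      neg_mul, hnorm]

lemma hasLaw_stdComplexGaussian [IsFiniteMeasure μ] (hh : IsIIDComplexGaussian μ 1 h) :
    HasLaw h (stdComplexGaussian (CVec L)) μ := by
  simpa using hh.hasLaw_inv_sqrt_smul one_pos

lemma hasLaw_normSq_div [IsFiniteMeasure μ] [NeZero L] (hh : IsIIDComplexGaussian μ v h)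
    (hv : 0 < v) : HasLaw (fun ω => ‖h ω‖ ^ 2 / v) (gammaMeasure L 1) μ := by
  have hlaw := hasLaw_normSq_stdComplexGaussian.comp (hh.hasLaw_inv_sqrt_smul hv)
  rw [finrank_euclideanSpace_fin] at hlaw
  refine hlaw.congr (.of_forall fun ω => ?_)
  simp [norm_smul, mul_pow, Real.sq_sqrt hv.le, div_eq_inv_mul]

lemma ae_ne_zero [IsFiniteMeasure μ] [NeZero L] (hh : IsIIDComplexGaussian μ v h) (hv : 0 < v) :
    ∀ᵐ ω ∂μ, h ω ≠ 0 := by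
  filter_upwards [((hh.hasLaw_normSq_div hv).ae_iff (by fun_prop)).2 (ae_pos_gammaMeasure L 1)]
    with ω hω hzero
  simp [hzero] at hω

lemma integral_normSq_div_pow [IsFiniteMeasure μ] [NeZero L] (hh : IsIIDComplexGaussian μ v h)
    (hv : 0 < v) (k : ℕ) :
    ∫ ω, (‖h ω‖ ^ 2 / v) ^ k ∂μ = Real.Gamma (L + k) / Real.Gamma L := by
  rw [← integral_pow_gammaMeasure (by exact_mod_cast NeZero.pos L),
    ← (hh.hasLaw_normSq_div hv).integral_comp (f := fun x => x ^ k) (by fun_prop)]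
  rfl

lemma integral_normSq [IsFiniteMeasure μ] [NeZero L] (hh : IsIIDComplexGaussian μ v h)
    (hv : 0 < v) : ∫ ω, ‖h ω‖ ^ 2 ∂μ = v * L := by
  have hL0 : (0 : ℝ) < L := by exact_mod_cast NeZero.pos L
  have hmean := hh.integral_normSq_div_pow hv 1
  simp only [pow_one, Nat.cast_one] at hmean
  rwa [integral_div, Real.Gamma_add_one hL0.ne',
    mul_div_cancel_right₀ _ (Real.Gamma_pos_of_pos hL0).ne', div_eq_iff hv.ne', mul_comm] at hmean

lemma integral_normSq_div_sq [IsFiniteMeasure μ] [NeZero L] (hh : IsIIDComplexGaussian μ v h)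
    (hv : 0 < v) : ∫ ω, (‖h ω‖ ^ 2 / v) ^ 2 ∂μ = L * (L + 1) := by
  have hL0 : (0 : ℝ) < L := by exact_mod_cast NeZero.pos L
  rw [hh.integral_normSq_div_pow hv, Nat.cast_two, ← one_add_one_eq_two, ← add_assoc,
    Real.Gamma_add_one (by positivity), Real.Gamma_add_one hL0.ne', ← mul_assoc,
    mul_div_cancel_right₀ _ (Real.Gamma_pos_of_pos hL0).ne', mul_comm]

lemma integrable_normSq_div_pow [IsFiniteMeasure μ] [NeZero L] (hh : IsIIDComplexGaussian μ v h)
    (hv : 0 < v) (k : ℕ) : Integrable (fun ω => (‖h ω‖ ^ 2 / v) ^ k) μ := by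
  have hlaw := hh.hasLaw_normSq_div hv
  have hpow := integrable_pow_gammaMeasure (s := L) (by exact_mod_cast NeZero.pos L) k
  rw [← hlaw.map_eq] at hpow
  exact hpow.comp_aemeasurable hlaw.aemeasurable

end IsIIDComplexGaussian

end ChannelLaws

section Quantizer

/-- The largest quantization error `2 ^ (-B / (L - 1))` that `B` feedback bits can leave, that is,
the right end of the support of the law with distribution function `cdiErrorCDF L B`. -/
def maxCdiError (L B : ℕ) : ℝ := 2 ^ (-((B : ℝ) / ((L : ℝ) - 1)))

variable {L B : ℕ}

lemma maxCdiError_pos (L B : ℕ) : 0 < maxCdiError L B := Real.rpow_pos_of_pos two_pos _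

lemma maxCdiError_sq (L B : ℕ) :
    maxCdiError L B ^ 2 = 2 ^ (-(2 * (B : ℝ) / ((L : ℝ) - 1))) := by
  rw [maxCdiError, ← Real.rpow_mul_natCast zero_le_two]
  congr 1
  push_cast
  ring

lemma two_pow_mul_maxCdiError_pow (hL : 1 < L) (B : ℕ) :
    (2 : ℝ) ^ B * maxCdiError L B ^ (L - 1) = 1 := by
  have hL1 : (L : ℝ) - 1 ≠ 0 := sub_ne_zero.2 (by exact_mod_cast hL.ne')
  rw [maxCdiError, ← Real.rpow_mul_natCast zero_le_two, Nat.cast_pred (by omega), neg_mul,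
    div_mul_cancel₀ _ hL1, Real.rpow_neg zero_le_two, Real.rpow_natCast]
  exact mul_inv_cancel₀ (by positivity)

lemma cdiErrorCDF_zero (hL : 1 < L) (B : ℕ) : cdiErrorCDF L B 0 = 0 := by
  rw [cdiErrorCDF, if_neg (lt_irrefl 0), if_pos (by positivity), zero_pow (by omega), mul_zero]

lemma cdiErrorCDF_maxCdiError (hL : 1 < L) (B : ℕ) : cdiErrorCDF L B (maxCdiError L B) = 1 := by
  rw [cdiErrorCDF, if_neg (maxCdiError_pos L B).not_gt, ← maxCdiError, if_pos le_rfl,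
    two_pow_mul_maxCdiError_pow hL]

lemma one_sub_cdiErrorCDF_eq_indicator {t : ℝ} (ht : 0 < t) :
    1 - cdiErrorCDF L B t
      = (Set.Ioc 0 (maxCdiError L B)).indicator (fun t => 1 - 2 ^ B * t ^ (L - 1)) t := by
  rw [cdiErrorCDF, if_neg ht.not_gt, ← maxCdiError]
  by_cases hle : t ≤ maxCdiError L B
  · rw [if_pos hle, Set.indicator_of_mem (Set.mem_Ioc.2 ⟨ht, hle⟩)]
  · rw [if_neg hle, sub_self, Set.indicator_of_notMem fun hmem => hle hmem.2]

lemma setIntegral_Ioi_one_sub_cdiErrorCDF (hL : 1 < L) (B : ℕ) :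
    ∫ t in Set.Ioi 0, (1 - cdiErrorCDF L B t) = ((L : ℝ) - 1) / L * maxCdiError L B := by
  have hpow : (2 : ℝ) ^ B * maxCdiError L B ^ L = maxCdiError L B := by
    rw [← pow_sub_one_mul (by omega : L ≠ 0), ← mul_assoc, two_pow_mul_maxCdiError_pow hL, one_mul]
  rw [setIntegral_congr_fun measurableSet_Ioi fun t ht => one_sub_cdiErrorCDF_eq_indicator ht,
    setIntegral_indicator measurableSet_Ioc, Set.inter_eq_right.2 Set.Ioc_subset_Ioi_self,
    ← intervalIntegral.integral_of_le (maxCdiError_pos L B).le,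
    intervalIntegral.integral_sub (by simp) (Continuous.intervalIntegrable (by fun_prop) _ _),
    intervalIntegral.integral_const_mul, integral_pow, Nat.sub_add_cancel hL.le,
    Nat.cast_pred (by omega), sub_add_cancel, zero_pow (by omega), ← mul_div_assoc, sub_zero, hpow,
    integral_one, sub_zero]
  have hL0 : (L : ℝ) ≠ 0 := by positivity
  field_simp

variable {Ω : Type*} [MeasurableSpace Ω] {μ : Measure Ω} [IsProbabilityMeasure μ] {X : Ω → ℝ}

lemma ae_le_of_cdf_eq_cdiErrorCDF (hL : 1 < L) (hX : AEMeasurable X μ)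
    (hcdf : ∀ τ, μ.real {ω | X ω ≤ τ} = cdiErrorCDF L B τ) :
    ∀ᵐ ω ∂μ, X ω ≤ maxCdiError L B := by
  have hone := (hcdf (maxCdiError L B)).trans (cdiErrorCDF_maxCdiError hL B)
  rw [measureReal_def, ENNReal.toReal_eq_one_iff] at hone
  exact (prob_compl_eq_zero_iff₀ (nullMeasurableSet_le hX aemeasurable_const)).2 hone

lemma ae_pos_of_cdf_eq_cdiErrorCDF (hL : 1 < L)
    (hcdf : ∀ τ, μ.real {ω | X ω ≤ τ} = cdiErrorCDF L B τ) : ∀ᵐ ω ∂μ, 0 < X ω := by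
  have hzero := (hcdf 0).trans (cdiErrorCDF_zero hL B)
  rw [measureReal_eq_zero_iff] at hzero
  simpa [ae_iff] using hzero

lemma integral_of_cdf_eq_cdiErrorCDF (hL : 1 < L) (hX : AEMeasurable X μ)
    (hcdf : ∀ τ, μ.real {ω | X ω ≤ τ} = cdiErrorCDF L B τ) :
    ∫ ω, X ω ∂μ = ((L : ℝ) - 1) / L * maxCdiError L B := by
  have hpos := ae_pos_of_cdf_eq_cdiErrorCDF hL hcdf
  have hint : Integrable X μ := by
    refine Integrable.of_bound hX.aestronglyMeasurable (maxCdiError L B) ?_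
    filter_upwards [hpos, ae_le_of_cdf_eq_cdiErrorCDF hL hX hcdf] with ω hω hle
    rwa [Real.norm_of_nonneg hω.le]
  rw [hint.integral_eq_integral_meas_lt (hpos.mono fun ω hω => hω.le),
    ← setIntegral_Ioi_one_sub_cdiErrorCDF hL B]
  refine integral_congr_ae (.of_forall fun t => ?_)
  have hcompl : {ω | t < X ω} = {ω | X ω ≤ t}ᶜ := by
    ext ω
    exact (not_le (a := X ω)).symm
  simp only [hcompl, ← hcdf]
  exact probReal_compl_eq_one_sub₀ (nullMeasurableSet_le hX aemeasurable_const)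

end Quantizer

namespace IsOCBFeedforward

variable {Ω : Type*} [MeasurableSpace Ω] {μ : Measure Ω} {p : Params} {B : ℕ} {hp : Ω → ℂ}
  {hx hs sHat f : Ω → CVec p.L}

lemma aemeasurable_crossLink (h : IsOCBFeedforward μ p B hp hx hs sHat f) :
    AEMeasurable (fun ω => (hx ω, sHat ω)) μ :=
  h.law_hx.aemeasurable.prodMk h.aemeasurable_sHat

lemma hasLaw_normSq_hp (h : IsOCBFeedforward μ p B hp hx hs sHat f) :
    HasLaw (fun ω => ‖hp ω‖ ^ 2) (expMeasure 1) μ :=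
  hasLaw_normSq_of_hasLaw_complexGaussian_one h.law_hp

lemma aemeasurable_cdiError (h : IsOCBFeedforward μ p B hp hx hs sHat f) :
    AEMeasurable (fun ω => cdiError (sHat ω) (shape (hx ω))) μ := by
  have hshape := measurable_shape.comp_aemeasurable h.law_hx.aemeasurable
  exact ((h.aemeasurable_sHat.inner hshape).norm.pow_const 2).const_sub 1

lemma aestronglyMeasurable_normSq_perp_pow (h : IsOCBFeedforward μ p B hp hx hs sHat f) (k : ℕ) :
    AEStronglyMeasurable (fun ω => (‖perp (sHat ω) (hx ω)‖ ^ 2) ^ k) μ := by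
  have hperp : Measurable fun q : CVec p.L × CVec p.L => (‖perp q.2 q.1‖ ^ 2) ^ k := by fun_prop
  exact (hperp.comp_aemeasurable h.aemeasurable_crossLink).aestronglyMeasurable

lemma ae_normSq_perp_eq (h : IsOCBFeedforward μ p B hp hx hs sHat f) :
    ∀ᵐ ω ∂μ, ‖perp (sHat ω) (hx ω)‖ ^ 2 = ‖hx ω‖ ^ 2 * cdiError (sHat ω) (shape (hx ω)) :=
  h.norm_sHat.mono fun ω hu => (normSq_mul_cdiError_shape hu (hx ω)).symm

variable [IsProbabilityMeasure μ]

lemma indepFun_crossLink (h : IsOCBFeedforward μ p B hp hx hs sHat f) :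
    IndepFun (fun ω => (hx ω, sHat ω)) (fun ω => (hs ω, ‖hp ω‖ ^ 2)) μ :=
  indepFun_prodMk_of_indepFun_prodMk h.aemeasurable_crossLink h.law_hs.aemeasurable
    h.hasLaw_normSq_hp.aemeasurable h.indep_hs
    (h.indep_hp.comp (ψ := fun z => ‖z‖ ^ 2) measurable_id (by fun_prop))

lemma hasLaw_hs_normSq_hp (h : IsOCBFeedforward μ p B hp hx hs sHat f) :
    HasLaw (fun ω => (hs ω, ‖hp ω‖ ^ 2))
      ((stdComplexGaussian (CVec p.L)).prod (expMeasure 1)) μ where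
  aemeasurable := h.law_hs.aemeasurable.prodMk h.hasLaw_normSq_hp.aemeasurable
  map_eq := by
    have hindep : IndepFun hs (fun ω => ‖hp ω‖ ^ 2) μ :=
      h.indep_hp.comp (ψ := fun z => ‖z‖ ^ 2) measurable_snd (by fun_prop)
    rw [(indepFun_iff_map_prod_eq_prod_map_map h.law_hs.aemeasurable
      h.hasLaw_normSq_hp.aemeasurable).1 hindep, h.law_hs.hasLaw_stdComplexGaussian.map_eq,
      h.hasLaw_normSq_hp.map_eq]

lemma ae_normSq_perp_le (h : IsOCBFeedforward μ p B hp hx hs sHat f) (hL : 1 < p.L) :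
    ∀ᵐ ω ∂μ, ‖perp (sHat ω) (hx ω)‖ ^ 2 ≤ ‖hx ω‖ ^ 2 * maxCdiError p.L B := by
  filter_upwards [h.ae_normSq_perp_eq,
    ae_le_of_cdf_eq_cdiErrorCDF hL h.aemeasurable_cdiError h.cdf_cdiError] with ω heq hle
  rw [heq]
  gcongr

lemma ae_perp_ne_zero (h : IsOCBFeedforward μ p B hp hx hs sHat f) (hL : 1 < p.L)
    (hlam : 0 < p.lam) : ∀ᵐ ω ∂μ, perp (sHat ω) (hx ω) ≠ 0 := by
  have : NeZero p.L := ⟨by omega⟩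
  filter_upwards [h.ae_normSq_perp_eq, h.law_hx.ae_ne_zero hlam,
    ae_pos_of_cdf_eq_cdiErrorCDF hL h.cdf_cdiError] with ω heq hne hpos hzero
  have hprod : 0 < ‖hx ω‖ ^ 2 * cdiError (sHat ω) (shape (hx ω)) := by positivity
  simp [← heq, hzero] at hprod

lemma ae_inner_perp_ne_zero (h : IsOCBFeedforward μ p B hp hx hs sHat f) (hL : 1 < p.L)
    (hlam : 0 < p.lam) : ∀ᵐ ω ∂μ, inner ℂ (hx ω) (perp (sHat ω) (hs ω)) ≠ 0 := by
  have hmeas : MeasurableSet {q : (CVec p.L × CVec p.L) × CVec p.L |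
      inner ℂ q.1.1 (perp q.1.2 q.2) ≠ 0} :=
    (measurableSet_singleton 0).compl.preimage (by fun_prop)
  refine ae_mem_of_indepFun h.indep_hs h.aemeasurable_crossLink h.law_hs.aemeasurable hmeas ?_
  rw [h.law_hs.hasLaw_stdComplexGaussian.map_eq]
  exact (h.ae_perp_ne_zero hL hlam).mono fun ω hω =>
    CognitiveBeamforming.ae_inner_perp_ne_zero hω

lemma outageProb_eq (h : IsOCBFeedforward μ p B hp hx hs sHat f) (hL : 1 < p.L)
    (hlam : 0 < p.lam) (hthetaP : 0 < p.thetaP) (hPp : 0 < p.Pp) (hPmax : 0 < p.Pmax)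
    (hnoise : 0 < p.noise) :
    outageProb μ p hs f = μ.real {ω | (hs ω, ‖hp ω‖ ^ 2) ∈ outageRegion (p.thetaS / p.gammaMax)
      (p.thetaP / p.gammaP) (p.thetaP / p.gammaP * p.thetaS) (hx ω) (sHat ω)} := by
  refine measureReal_congr ?_
  filter_upwards [h.norm_sHat, h.ae_inner_perp_ne_zero hL hlam, h.beamformer] with ω hu hne hf
  exact propext (snrS_le_iff_mem_outageRegion hlam hthetaP hPp hPmax hnoise hu hne hf)

lemma integrable_normSq_perp_pow (h : IsOCBFeedforward μ p B hp hx hs sHat f) (hL : 1 < p.L)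
    (hlam : 0 < p.lam) (k : ℕ) : Integrable (fun ω => (‖perp (sHat ω) (hx ω)‖ ^ 2) ^ k) μ := by
  have : NeZero p.L := ⟨by omega⟩
  refine ((h.law_hx.integrable_normSq_div_pow hlam k).mul_const
    ((p.lam * maxCdiError p.L B) ^ k)).mono' (h.aestronglyMeasurable_normSq_perp_pow k) ?_
  filter_upwards [h.ae_normSq_perp_le hL] with ω hle
  rw [Real.norm_of_nonneg (by positivity), ← mul_pow, ← mul_assoc, div_mul_cancel₀ _ hlam.ne']
  gcongr

lemma integral_normSq_perp (h : IsOCBFeedforward μ p B hp hx hs sHat f) (hL : 1 < p.L)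
    (hlam : 0 < p.lam) :
    ∫ ω, ‖perp (sHat ω) (hx ω)‖ ^ 2 ∂μ = p.lam * (p.L - 1) * maxCdiError p.L B := by
  have : NeZero p.L := ⟨by omega⟩
  have hcdiError : Measurable fun q : CVec p.L × CVec p.L => cdiError q.2 q.1 := by
    unfold cdiError
    fun_prop
  have hindep : IndepFun (fun ω => ‖hx ω‖ ^ 2) (fun ω => cdiError (sHat ω) (shape (hx ω))) μ :=
    h.indep_gain.comp (measurable_id.pow_const 2) hcdiError
  rw [integral_congr_ae h.ae_normSq_perp_eq, hindep.integral_fun_mul_eq_mul_integral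
    (h.law_hx.aemeasurable.norm.pow_const 2).aestronglyMeasurable
    h.aemeasurable_cdiError.aestronglyMeasurable, h.law_hx.integral_normSq hlam,
    integral_of_cdf_eq_cdiErrorCDF hL h.aemeasurable_cdiError h.cdf_cdiError]
  field_simp

lemma integral_normSq_perp_sq_le (h : IsOCBFeedforward μ p B hp hx hs sHat f) (hL : 1 < p.L)
    (hlam : 0 < p.lam) :
    ∫ ω, (‖perp (sHat ω) (hx ω)‖ ^ 2) ^ 2 ∂μ
      ≤ p.lam ^ 2 * (p.L * (p.L + 1)) * maxCdiError p.L B ^ 2 := by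
  have : NeZero p.L := ⟨by omega⟩
  have hbound : ∀ᵐ ω ∂μ, (‖perp (sHat ω) (hx ω)‖ ^ 2) ^ 2
      ≤ (‖hx ω‖ ^ 2 / p.lam) ^ 2 * (p.lam * maxCdiError p.L B) ^ 2 := by
    filter_upwards [h.ae_normSq_perp_le hL] with ω hle
    rw [← mul_pow, ← mul_assoc, div_mul_cancel₀ _ hlam.ne']
    gcongr
  refine (integral_mono_ae (h.integrable_normSq_perp_pow hL hlam 2)
    ((h.law_hx.integrable_normSq_div_pow hlam 2).mul_const _) hbound).trans_eq ?_
  rw [integral_mul_const, h.law_hx.integral_normSq_div_sq hlam]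
  ring

lemma abs_outageProb_sub_le (h : IsOCBFeedforward μ p B hp hx hs sHat f) (hL : 1 < p.L)
    (hlam : 0 < p.lam) (hthetaP : 0 < p.thetaP) (hthetaS : 0 < p.thetaS) (hPp : 0 < p.Pp)
    (hPmax : 0 < p.Pmax) (hnoise : 0 < p.noise) :
    |outageProb μ p hs f -
      (1 - upperGamma (p.L - 1) (p.thetaS / p.gammaMax) / Real.Gamma (p.L - 1) +
        Real.exp (-(p.thetaP / p.gammaP)) * (p.thetaP / p.gammaP * p.thetaS *
          ((∫ ω, ‖perp (sHat ω) (hx ω)‖ ^ 2 ∂μ) / (p.L - 1) *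
            (upperGamma (p.L - 2) (p.thetaS / p.gammaMax) / Real.Gamma (p.L - 1)))))|
      ≤ (p.thetaP * p.gammaMax / p.gammaP) ^ 2 / 2 *
        ∫ ω, (‖perp (sHat ω) (hx ω)‖ ^ 2) ^ 2 ∂μ := by
  have hgammaP : 0 < p.gammaP := div_pos hPp hnoise
  have hgammaMax : 0 < p.gammaMax := div_pos hPmax hnoise
  have hint : Integrable (fun ω => ‖perp (sHat ω) (hx ω)‖ ^ 2) μ := by
    simpa only [pow_one] using h.integrable_normSq_perp_pow hL hlam 1
  have hmain := (((hint.div_const (p.L - 1 : ℝ)).mul_const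
    (upperGamma (p.L - 2) (p.thetaS / p.gammaMax) / Real.Gamma (p.L - 1))).const_mul
      (p.thetaP / p.gammaP * p.thetaS)).const_mul (Real.exp (-(p.thetaP / p.gammaP)))
  have hbound := abs_measureReal_mem_sub_integral_le_of_indepFun h.indepFun_crossLink
    h.aemeasurable_crossLink h.hasLaw_hs_normSq_hp.aemeasurable
    (measurableSet_outageRegion (p.thetaS / p.gammaMax) (p.thetaP / p.gammaP)
      (p.thetaP / p.gammaP * p.thetaS))
    ((integrable_const (1 - upperGamma (p.L - 1) (p.thetaS / p.gammaMax) /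
      Real.Gamma (p.L - 1))).add hmain)
    ((h.integrable_normSq_perp_pow hL hlam 2).const_mul
      ((p.thetaP * p.gammaMax / p.gammaP) ^ 2 / 2)) ?_
  · simp only [Pi.add_apply] at hbound
    rw [integral_add (integrable_const _) hmain, integral_const_mul, integral_const_mul,
      integral_const_mul, integral_mul_const, integral_div] at hbound
    rw [h.outageProb_eq hL hlam hthetaP hPp hPmax hnoise]
    simpa using hbound
  · filter_upwards [h.norm_sHat] with ω hu
    have hcond := abs_measureReal_outageRegion_sub_le hu
      (by rwa [finrank_euclideanSpace_fin]) (div_pos hthetaS hgammaMax)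
      (div_pos hthetaP hgammaP).le (mul_pos (div_pos hthetaP hgammaP) hthetaS).le (hx ω)
    rw [finrank_euclideanSpace_fin] at hcond
    rw [h.hasLaw_hs_normSq_hp.map_eq]
    refine hcond.trans_eq ?_
    field_simp

end IsOCBFeedforward

end CognitiveBeamforming

end

open CognitiveBeamforming

theorem mainTheorem2_general {Ω : Type*} [MeasurableSpace Ω] {μ : Measure Ω}
    [IsProbabilityMeasure μ] {p : Params} {B : ℕ} {hp : Ω → ℂ} {hx hs sHat f : Ω → CVec p.L}
    (hL : 2 ≤ p.L) (hlam : 0 < p.lam) (hthetaP : 0 < p.thetaP) (hthetaS : 0 < p.thetaS)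
    (hPp : 0 < p.Pp) (hPmax : 0 < p.Pmax) (hnoise : 0 < p.noise)
    (h : IsOCBFeedforward μ p B hp hx hs sHat f) :
    |outageProb μ p hs f -
        (1 - upperGamma ((p.L : ℝ) - 1) (p.thetaS / p.gammaMax) / Real.Gamma ((p.L : ℝ) - 1) +
          p.phi / ((p.L : ℝ) - 1) * (2 : ℝ) ^ (-((B : ℝ) / ((p.L : ℝ) - 1))))| ≤
      (p.lam * p.thetaP * p.gammaMax / p.gammaP) ^ 2 / 2 * (p.L * (p.L + 1)) *
        (2 : ℝ) ^ (-(2 * (B : ℝ) / ((p.L : ℝ) - 1))) := by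
  have hbound := h.abs_outageProb_sub_le hL hlam hthetaP hthetaS hPp hPmax hnoise
  have hfirstOrder : Real.exp (-(p.thetaP / p.gammaP)) * (p.thetaP / p.gammaP * p.thetaS *
      (p.lam * (p.L - 1) * maxCdiError p.L B / (p.L - 1) *
        (upperGamma (p.L - 2) (p.thetaS / p.gammaMax) / Real.Gamma (p.L - 1))))
      = p.phi / ((p.L : ℝ) - 1) * maxCdiError p.L B := by
    rw [Params.phi]
    ring
  rw [h.integral_normSq_perp hL hlam, hfirstOrder] at hbound
  rw [← maxCdiError_sq]
  refine hbound.trans ?_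
  calc (p.thetaP * p.gammaMax / p.gammaP) ^ 2 / 2 * ∫ ω, (‖perp (sHat ω) (hx ω)‖ ^ 2) ^ 2 ∂μ
      ≤ (p.thetaP * p.gammaMax / p.gammaP) ^ 2 / 2 *
          (p.lam ^ 2 * (p.L * (p.L + 1)) * maxCdiError p.L B ^ 2) := by
        gcongr
        exact h.integral_normSq_perp_sq_le hL hlam
    _ = _ := by ring

theorem mainTheorem2 (p : CognitiveBeamforming.Params) (hL : 2 ≤ p.L)
    (hlam : 0 < p.lam) (hlam1 : p.lam < 1) (hthetaP : 0 < p.thetaP) (hthetaS : 0 < p.thetaS)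
    (hPp : 0 < p.Pp) (hPmax : 0 < p.Pmax) (hnoise : 0 < p.noise) :
    ∃ C : ℝ, ∀ (B : ℕ) (Ω : Type*) [MeasurableSpace Ω] (μ : Measure Ω) [IsProbabilityMeasure μ]
      (hp : Ω → ℂ) (hx hs sHat f : Ω → CognitiveBeamforming.CVec p.L),
      CognitiveBeamforming.IsOCBFeedforward μ p B hp hx hs sHat f →
      |CognitiveBeamforming.outageProb μ p hs f -
          (1 - CognitiveBeamforming.upperGamma ((p.L : ℝ) - 1) (p.thetaS / p.gammaMax) /
              Real.Gamma ((p.L : ℝ) - 1) +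
            p.phi / ((p.L : ℝ) - 1) * (2 : ℝ) ^ (-((B : ℝ) / ((p.L : ℝ) - 1))))| ≤
        C * (2 : ℝ) ^ (-(2 * (B : ℝ) / ((p.L : ℝ) - 1))) :=
  ⟨_, fun _ _ _ _ _ _ _ _ _ _ h =>
    mainTheorem2_general hL hlam hthetaP hthetaS hPp hPmax hnoise h⟩
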